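/- **Definitions.** Let $G=(V,E)$ be a finite undirected loopless graph and $s\in V$. A *broadcast protocol* with $t$ rounds from $s$ is a spanning tree $T$ of $G$ rooted at $s$ together with a map $\tau\colon E(T)\to\{1,\dots,t\}$ that is a proper coloring of the edges of $T$ and such that for every $v\in V\setminus\{s\}$ the edge from $v$ to its parent has the minimum value of $\tau$ among all edges of $T$ incident with $v$. Let $b(G,s)$ be the least $t$ for which such a protocol exists ($b(G,s)=\infty$ if there is none, i.e. if $G$ is disconnected). A *nice tree decomposition* of $G$ is a rooted tree decomposition of $G$ in which the root has an empty bag and every node is a leaf with an empty bag, an introduce node (exactly one child, whose bag is the bag of the node minus one vertex), a forget node (exactly one child, whose bag is the bag of the node plus one vertex), or a join node (exactly two children, with the same bag as the node). Its *width* is the maximum size of a bag minus one. **Theorem.** There is an algorithm which takes as input an $n$-vertex graph $G$, a vertex $s$ of $G$, an integer $t\ge 0$, and a nice tree decomposition of $G$ of width $\mathrm{tw}$ with $N$ nodes, and determines whether $b(G,s)\le t$ in time $2^{O(t\cdot \mathrm{tw})}(n+N)^{O(1)}$. In particular, on nice tree decompositions with $N\le n^{O(1)}$ nodes it runs in time $2^{O(t\cdot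 \mathrm{tw})}n^{O(1)}$. Here an algorithm is a program for a random access machine with unit-cost instructions (constants, addition, truncated subtraction, indirect load and store, tests for zero) whose input, consisting of $n,s,t,N$, the root, the adjacency matrix of $G$, the parents of the nodes of the decomposition, and the incidence matrix of bags and vertices, is given in its memory. The time bound $2^{O(t\cdot \mathrm{tw})}(n+N)^{O(1)}$ means at most $c\cdot 2^{c\,t\,\mathrm{tw}}(n+N)^c$ steps for a constant $c$ that depends on nothing. In the second bound, $N\le n^{O(1)}$ means $N\le a\,n^a$ for a constant $a$, and the time is at most $c\cdot 2^{c\,t\,\mathrm{tw}}n^c$ with $c$ depending only on $a$. -/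

import Mathlib

/-! ### Telephone broadcasting -/

/-- A broadcast protocol in `G` from `s` with `t` rounds: a spanning tree `T` of `G`, rooted at `s`,
with time stamps `τ` on its edges (only the values of `τ` on edges of `T` matter).  In the tree `T`
rooted at `s`, `p` is the parent of `v` iff they are adjacent and `v` is one step further from `s`. -/
structure IsBroadcastProtocol {V : Type*} (G : SimpleGraph V) (s : V) (t : ℕ)
    (T : SimpleGraph V) (τ : Sym2 V → ℕ) : Prop where
  le : T ≤ G
  isTree : T.IsTree
  mem_Icc : ∀ e ∈ T.edgeSet, 1 ≤ τ e ∧ τ e ≤ t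
  proper : ∀ u v w, T.Adj u v → T.Adj u w → v ≠ w → τ s(u, v) ≠ τ s(u, w)
  parent_first : ∀ v p w, T.Adj v p → T.dist s v = T.dist s p + 1 → T.Adj v w →
    τ s(v, p) ≤ τ s(v, w)

/-- `b(G, s)`: the least number of rounds of a broadcast protocol in `G` from `s`
(it is `⊤` if there is none, which for finite `G` means that `G` is disconnected). -/
noncomputable def broadcastTime {V : Type*} (G : SimpleGraph V) (s : V) : ℕ∞ :=
  sInf {b : ℕ∞ | ∃ t : ℕ, b = t ∧ ∃ T τ, IsBroadcastProtocol G s t T τ}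

/-! ### Nice tree decompositions -/

/-- A (rooted) tree decomposition of a graph with vertex set `Fin n`.  The tree has the nodes
`0, …, size - 1` and is given by its root and its parent function, where the root is by convention
its own parent. -/
structure TreeDecomposition {n : ℕ} (G : SimpleGraph (Fin n)) where
  size : ℕ
  root : Fin size
  parent : Fin size → Fin size
  parent_root : parent root = root
  reaches_root : ∀ x, ∃ k : ℕ, parent^[k] x = root
  bag : Fin size → Finset (Fin n)
  vertex_covered : ∀ v, ∃ x, v ∈ bag x
  edge_covered : ∀ u v, G.Adj u v → ∃ x, u ∈ bag x ∧ v ∈ bag x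
  connected : ∀ v,
    ((SimpleGraph.fromRel fun x y => parent x = y).induce {x | v ∈ bag x}).Connected

namespace TreeDecomposition

variable {n : ℕ} {G : SimpleGraph (Fin n)} (D : TreeDecomposition G)

/-- The maximal size of a bag, minus one. -/
def width : ℕ := (Finset.univ.sup fun x => (D.bag x).card) - 1

/-- The set of children of a node. -/
def children (x : Fin D.size) : Set (Fin D.size) := {y | y ≠ D.root ∧ D.parent y = x}

def IsLeafNode (x : Fin D.size) : Prop := D.children x = ∅ ∧ D.bag x = ∅

def IsIntroduceNode (x : Fin D.size) : Prop :=
  ∃ y v, D.children x = {y} ∧ v ∉ D.bag y ∧ D.bag x = insert v (D.bag y)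

def IsForgetNode (x : Fin D.size) : Prop :=
  ∃ y v, D.children x = {y} ∧ v ∉ D.bag x ∧ D.bag y = insert v (D.bag x)

def IsJoinNode (x : Fin D.size) : Prop :=
  ∃ y z, y ≠ z ∧ D.children x = {y, z} ∧ D.bag y = D.bag x ∧ D.bag z = D.bag x

/-- A tree decomposition is nice if its root has an empty bag and each of its nodes is a leaf
(with an empty bag), an introduce node, a forget node, or a join node. -/
structure IsNice : Prop where
  root_bag : D.bag D.root = ∅
  nodes : ∀ x, D.IsLeafNode x ∨ D.IsIntroduceNode x ∨ D.IsForgetNode x ∨ D.IsJoinNode x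

end TreeDecomposition

/-! ### Random access machines -/

namespace RAM

/-- A state of the machine: registers and main memory, all of whose cells hold natural numbers. -/
structure State where
  reg : ℕ → ℕ
  mem : ℕ → ℕ

/-- Programs of a random access machine with structured control flow.  A program is a finite object,
so it mentions only finitely many registers; the memory is accessed through addresses that are held
in registers.  The only arithmetic operations are addition and truncated subtraction. -/
inductive Program where
  /-- do nothing -/
  | skip
  /-- `reg x := c` -/
  | const (x c : ℕ)
  /-- `reg x := reg y + reg z` -/
  | add (x y z : ℕ)
  /-- `reg x := reg y - reg z` -/
  | sub (x y z : ℕ)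
  /-- `reg x := mem (reg y)` -/
  | load (x y : ℕ)
  /-- `mem (reg x) := reg y` -/
  | store (x y : ℕ)
  /-- `P; Q` -/
  | seq (P Q : Program)
  /-- if `reg x ≠ 0` then `P` else `Q` -/
  | ifNonzero (x : ℕ) (P Q : Program)
  /-- while `reg x ≠ 0` do `P` -/
  | whileNonzero (x : ℕ) (P : Program)

/-- `Exec P σ k σ'`: started in the state `σ`, the program `P` halts in the state `σ'` after exactly
`k` steps, where each elementary instruction and each test of a register counts as one step. -/
inductive Exec : Program → State → ℕ → State → Prop
  | skip (σ : State) : Exec .skip σ 1 σ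
  | const (x c : ℕ) (σ : State) :
      Exec (.const x c) σ 1 { σ with reg := Function.update σ.reg x c }
  | add (x y z : ℕ) (σ : State) :
      Exec (.add x y z) σ 1 { σ with reg := Function.update σ.reg x (σ.reg y + σ.reg z) }
  | sub (x y z : ℕ) (σ : State) :
      Exec (.sub x y z) σ 1 { σ with reg := Function.update σ.reg x (σ.reg y - σ.reg z) }
  | load (x y : ℕ) (σ : State) :
      Exec (.load x y) σ 1 { σ with reg := Function.update σ.reg x (σ.mem (σ.reg y)) }
  | store (x y : ℕ) (σ : State) :
      Exec (.store x y) σ 1 { σ with mem := Function.update σ.mem (σ.reg x) (σ.reg y) }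
  | seq {P Q : Program} {σ σ' σ'' : State} {k l : ℕ} :
      Exec P σ k σ' → Exec Q σ' l σ'' → Exec (.seq P Q) σ (k + l) σ''
  | if_true {x : ℕ} {P Q : Program} {σ σ' : State} {k : ℕ} :
      σ.reg x ≠ 0 → Exec P σ k σ' → Exec (.ifNonzero x P Q) σ (k + 1) σ'
  | if_false {x : ℕ} {P Q : Program} {σ σ' : State} {k : ℕ} :
      σ.reg x = 0 → Exec Q σ k σ' → Exec (.ifNonzero x P Q) σ (k + 1) σ'
  | while_done {x : ℕ} {P : Program} {σ : State} :
      σ.reg x = 0 → Exec (.whileNonzero x P) σ 1 σ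
  | while_step {x : ℕ} {P : Program} {σ σ' σ'' : State} {k l : ℕ} :
      σ.reg x ≠ 0 → Exec P σ k σ' → Exec (.whileNonzero x P) σ' l σ'' →
      Exec (.whileNonzero x P) σ (k + l + 1) σ''

/-- The start state on an input word: the word stands at the beginning of the memory, and all
registers and all other memory cells are zero. -/
def initial (input : List ℕ) : State where
  reg _ := 0
  mem i := input.getD i 0

/-- On this input, `P` halts after at most `B` steps, with `output` in register `0`. -/
def OutputsWithin (P : Program) (input : List ℕ) (output B : ℕ) : Prop :=
  ∃ k ≤ B, ∃ σ : State, Exec P (initial input) k σ ∧ σ.reg 0 = output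

end RAM

/-! ### The algorithmic problem -/

open Classical in
/-- The input word: `n`, `s`, `t`, the number of nodes and the root of the tree decomposition,
the rows of the adjacency matrix of `G`, the list of the parents of all nodes, and the rows of the
incidence matrix of bags and vertices. -/
noncomputable def encodeInput {n : ℕ} (G : SimpleGraph (Fin n)) (s : Fin n) (t : ℕ)
    (D : TreeDecomposition G) : List ℕ :=
  [n, s, t, D.size, D.root]
    ++ (List.finRange n).flatMap (fun u => (List.finRange n).map fun v => if G.Adj u v then 1 else 0)
    ++ (List.finRange D.size).map (fun x => (D.parent x : ℕ))
    ++ (List.finRange D.size).flatMap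
        (fun x => (List.finRange n).map fun v => if v ∈ D.bag x then 1 else 0)

open Classical in
/-- The correct answer, as a bit, to the question whether `b(G, s) ≤ t`. -/
noncomputable def broadcastAnswer {n : ℕ} (G : SimpleGraph (Fin n)) (s : Fin n) (t : ℕ) : ℕ :=
  if broadcastTime G s ≤ t then 1 else 0

/-! A broadcast protocol amounts to a schedule: each vertex other than `s` has a caller and a time,
times increase from caller to callee, and no vertex makes two calls at the same time
(`broadcastTime_le_iff`). Whether a schedule exists is decided by dynamic programming over the tree
decomposition.

The only condition that is not visible inside a single bag is that two callees `v`, `w` of `u` have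
different times, since `v` and `w` need not share a bag. Hence a node also stores, for each vertex
`u` of its bag and each time `i`, the index `q u i` of the child subtree holding the callee of `u`
at time `i` if that callee is no longer in the bag. In a nice decomposition this is one of the
values 0, 1, 2. If two callees of `u` had the same time, follow both calls upwards to a common
ancestor whose bag contains `u`: there the marks contradict each other
(`exists_isSchedule_of_states`). Conversely, every schedule induces such marks, because a vertex
missing from a bag lies below at most one child (`below_unique`). `exists_alive_decode_iff` combines
both directions, with states coded as numbers.

A vertex has `(t + 1) * n * 3 ^ (t + 1)` possible records. The number of informed vertices at most
doubles per round, so a schedule forces `n ≤ 2 ^ t` (`IsSchedule.card_le_two_pow`); the callers can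
then be stored by name, and there are at most `2 ^ (12 * (t * width))` states per node once some bag
has two vertices (`numStates_le`). The remaining inputs are answered directly: a schedule exists
only if `n = 1`.

For the machine, the algorithm is written in a small language of expressions with bounded loops.
`runs_compile` translates it to machine code, and `time_le` bounds the running time by a polynomial
in any bound `X` on the lengths of the loops. As `X` may be `2 ^ (O(t * width))` times a polynomial
in `n + N`, even crude arithmetic, such as division by counting, is fast enough. -/

/-! ### Schedules -/

/-- A schedule: `a v` is the round in which `v` is informed, by its neighbour `p v`. -/
structure IsSchedule {V : Type*} (G : SimpleGraph V) (s : V) (t : ℕ) (a : V → ℕ) (p : V → V) :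
    Prop where
  adj : ∀ v, v ≠ s → G.Adj v (p v)
  lt : ∀ v, v ≠ s → a (p v) < a v
  le : ∀ v, a v ≤ t
  inj : ∀ v w, v ≠ w → v ≠ s → w ≠ s → p v = p w → a v ≠ a w

/-- The caller is the next vertex on a shortest path in `T` to `s`, and the time is the stamp of
that edge. Along calls, `parent_first` gives `≤` between times and `proper` excludes equality. -/
theorem IsBroadcastProtocol.exists_isSchedule {V : Type*} {G : SimpleGraph V} {s : V} {t : ℕ}
    {T : SimpleGraph V} {τ : Sym2 V → ℕ} (h : IsBroadcastProtocol G s t T τ) :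
    ∃ a p, IsSchedule G s t a p := by
  classical
  have hex : ∀ v, ∃ q, v ≠ s → T.Adj v q ∧ T.dist s v = T.dist s q + 1 := by
    intro v
    by_cases hv : v = s
    · exact ⟨v, fun h => absurd hv h⟩
    obtain ⟨w, hw⟩ := (h.isTree.connected.preconnected v s).exists_walk_length_eq_dist
    cases w with
    | nil => exact absurd rfl hv
    | cons hadj w' =>
      rename_i q
      refine ⟨q, fun _ => ⟨hadj, ?_⟩⟩
      rw [SimpleGraph.Walk.length_cons] at hw
      have h1 : T.dist q s ≤ w'.length := SimpleGraph.dist_le w'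
      have h2 : T.dist v s ≤ T.dist q s + 1 := by
        obtain ⟨u, hu⟩ := (h.isTree.connected.preconnected q s).exists_walk_length_eq_dist
        have := SimpleGraph.dist_le (SimpleGraph.Walk.cons hadj u)
        rw [SimpleGraph.Walk.length_cons] at this
        omega
      rw [SimpleGraph.dist_comm (u := s) (v := v), SimpleGraph.dist_comm (u := s) (v := q)]
      omega
  choose p hp using hex
  -- All stamps are at least 1, so time 0 puts the source before its callees.
  refine ⟨fun v => if v = s then 0 else τ s(v, p v), p, ?_, ?_, ?_, ?_⟩
  · intro v hv
    exact h.le (hp v hv).1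
  · intro v hv
    simp only [hv, if_false]
    by_cases hps : p v = s
    · simp only [hps, if_true]
      have := (h.mem_Icc s(v, p v) (hp v hv).1).1
      rw [hps] at this
      omega
    · simp only [hps, if_false]
      have h1 := h.parent_first (p v) (p (p v)) v (hp _ hps).1 (hp _ hps).2 (hp v hv).1.symm
      have h2 := h.proper (p v) (p (p v)) v (hp _ hps).1 (hp v hv).1.symm (by
        intro heq
        have e1 := (hp _ hps).2
        have e2 := (hp v hv).2
        rw [heq] at e1
        omega)
      rw [Sym2.eq_swap (a := v)]
      omega
  · intro v
    by_cases hv : v = s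
    · simp only [hv, if_true, Nat.zero_le]
    · simp only [hv, if_false]
      exact (h.mem_Icc s(v, p v) (hp v hv).1).2
  · intro v w hvw hv hw hpp
    simp only [hv, hw, if_false]
    have := h.proper (p v) v w (hp v hv).1.symm (hpp ▸ (hp w hw).1.symm) hvw
    rw [Sym2.eq_swap (a := p v), Sym2.eq_swap (a := p v)] at this
    rwa [hpp] at this ⊢

/-! ### The tree of a schedule -/

namespace IsSchedule

variable {V : Type*} {G : SimpleGraph V} {s : V} {t : ℕ} {a : V → ℕ} {p : V → V}

/-- The graph of all edges along which the information is passed on. -/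
def tree (s : V) (p : V → V) : SimpleGraph V := SimpleGraph.fromRel fun v w => v ≠ s ∧ p v = w

theorem tree_adj (h : IsSchedule G s t a p) {v w : V} :
    (tree s p).Adj v w ↔ (v ≠ s ∧ p v = w) ∨ (w ≠ s ∧ p w = v) := by
  rw [tree, SimpleGraph.fromRel_adj]
  constructor
  · exact fun h => h.2
  · refine fun h' => ⟨?_, h'⟩
    rintro rfl
    rcases h' with ⟨hv, e⟩ | ⟨hv, e⟩ <;> exact (h.adj v hv).ne e.symm

/-- Times strictly decrease from a vertex to its caller, so iterating `p` reaches `s`; the depth is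
the number of iterations needed. -/
theorem exists_depth (h : IsSchedule G s t a p) :
    ∃ f : V → ℕ, f s = 0 ∧ ∀ v, v ≠ s → f v = f (p v) + 1 := by
  classical
  have key : ∀ k v, a v ≤ k → ∃ j, (fun v => if v = s then s else p v)^[j] v = s := by
    intro k
    induction k with
    | zero =>
      intro v hv
      by_cases hs : v = s
      · exact ⟨0, hs⟩
      · have := h.lt v hs
        omega
    | succ k ih =>
      intro v hv
      by_cases hs : v = s
      · exact ⟨0, hs⟩
      · have := h.lt v hs
        obtain ⟨j, hj⟩ := ih (p v) (by omega)
        exact ⟨j + 1, by rw [Function.iterate_succ_apply, if_neg hs, hj]⟩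
  have hex := fun v => key (a v) v le_rfl
  refine ⟨fun v => Nat.find (hex v), ?_, ?_⟩
  · rw [Nat.find_eq_zero]; rfl
  · intro v hv
    rw [Nat.find_eq_iff]
    refine ⟨?_, ?_⟩
    · rw [Function.iterate_succ_apply, if_neg hv]
      exact Nat.find_spec (hex (p v))
    · intro j hj
      cases j with
      | zero => exact hv
      | succ j =>
        rw [Function.iterate_succ_apply, if_neg hv]
        exact Nat.find_min (hex (p v)) (Nat.lt_of_succ_lt_succ hj)

theorem tree_connected (h : IsSchedule G s t a p) : (tree s p).Connected := by
  have key : ∀ k v, a v ≤ k → (tree s p).Reachable v s := by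
    intro k
    induction k with
    | zero =>
      intro v hv
      by_cases hs : v = s
      · rw [hs]
      · have := h.lt v hs
        omega
    | succ k ih =>
      intro v hv
      by_cases hs : v = s
      · rw [hs]
      · have := h.lt v hs
        exact (SimpleGraph.Adj.reachable (h.tree_adj.2 (Or.inl ⟨hs, rfl⟩))).trans
          (ih (p v) (by omega))
  have : Nonempty V := ⟨s⟩
  exact ⟨fun v w => (key _ v le_rfl).trans (key _ w le_rfl).symm⟩

/-- Following callers gives a walk of length `f v`, and no walk is shorter because `f` changes by
one along every edge. This is needed because `parent_first` recognizes parents by their distance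
from `s`. -/
theorem tree_dist (h : IsSchedule G s t a p) {f : V → ℕ} (hs : f s = 0)
    (hf : ∀ v, v ≠ s → f v = f (p v) + 1) (v : V) : (tree s p).dist s v = f v := by
  apply le_antisymm
  · have key : ∀ k v, f v = k → ∃ w : (tree s p).Walk v s, w.length = k := by
      intro k
      induction k with
      | zero =>
        intro v hv
        by_cases hvs : v = s
        · subst hvs
          exact ⟨.nil, rfl⟩
        · have := hf v hvs
          omega
      | succ k ih =>
        intro v hv
        have hvs : v ≠ s := by
          rintro rfl
          omega
        obtain ⟨w, hw⟩ := ih (p v) (by have := hf v hvs; omega)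
        exact ⟨.cons (h.tree_adj.2 (Or.inl ⟨hvs, rfl⟩)) w, by simp [hw]⟩
    obtain ⟨w, hw⟩ := key _ v rfl
    rw [SimpleGraph.dist_comm, ← hw]
    exact SimpleGraph.dist_le w
  · obtain ⟨w, hw⟩ := (h.tree_connected.preconnected v s).exists_walk_length_eq_dist
    rw [SimpleGraph.dist_comm, ← hw]
    clear hw
    have key : ∀ u v (w : (tree s p).Walk v u), f v ≤ f u + w.length := by
      intro u v w
      induction w with
      | nil => simp
      | cons hadj w ih =>
        rw [SimpleGraph.Walk.length_cons]
        rcases h.tree_adj.1 hadj with ⟨h1, rfl⟩ | ⟨h1, rfl⟩ <;> have := hf _ h1 <;> omega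
    have := key s v w
    omega

/-- Every edge has the form `s(v, p v)` with `v ≠ s`, so there is at most one edge per vertex other
than `s`; a connected graph with so few edges is a tree. -/
theorem tree_isTree [Finite V] (h : IsSchedule G s t a p) : (tree s p).IsTree := by
  classical
  have := Fintype.ofFinite V
  refine SimpleGraph.isTree_iff_connected_and_card.2 ⟨h.tree_connected, ?_⟩
  apply le_antisymm
  · have hsub : (tree s p).edgeSet ⊆
        ((Finset.univ.erase s).image fun v => s(v, p v) : Finset (Sym2 V)) := by
      intro e
      induction e with
      | h v w =>
        rw [SimpleGraph.mem_edgeSet, h.tree_adj]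
        rintro (⟨h1, rfl⟩ | ⟨h1, rfl⟩)
        · simp only [Finset.coe_image, Set.mem_image, Finset.mem_coe, Finset.mem_erase]
          exact ⟨v, ⟨h1, Finset.mem_univ _⟩, rfl⟩
        · simp only [Finset.coe_image, Set.mem_image, Finset.mem_coe, Finset.mem_erase]
          exact ⟨w, ⟨h1, Finset.mem_univ _⟩, Sym2.eq_swap⟩
    have h1 := Nat.card_mono (Finset.finite_toSet _) hsub
    have h2 := Finset.card_image_le (s := Finset.univ.erase s) (f := fun v => s(v, p v))
    rw [Finset.card_erase_of_mem (Finset.mem_univ _), Finset.card_univ] at h2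
    rw [Nat.card_eq_card_finite_toFinset (Finset.finite_toSet _)] at h1
    simp only [Finset.finite_toSet_toFinset] at h1
    have h3 : 0 < Fintype.card V := Fintype.card_pos_iff.2 ⟨s⟩
    rw [Nat.card_eq_fintype_card (α := V)]
    omega
  · exact h.tree_connected.card_vert_le_card_edgeSet_add_one

/-- The larger of the two times at an edge is that of the callee, so this symmetric formula stamps
each edge with the round of its call. -/
theorem isBroadcastProtocol [Finite V] (h : IsSchedule G s t a p) :
    IsBroadcastProtocol G s t (tree s p)
      (Sym2.lift ⟨fun v w => max (a v) (a w), fun _ _ => max_comm _ _⟩) := by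
  have up : ∀ v, v ≠ s → max (a v) (a (p v)) = a v := fun v hv => max_eq_left (h.lt v hv).le
  have down : ∀ v, v ≠ s → max (a (p v)) (a v) = a v := fun v hv => max_eq_right (h.lt v hv).le
  refine ⟨?_, h.tree_isTree, ?_, ?_, ?_⟩
  · intro v w hvw
    rcases h.tree_adj.1 hvw with ⟨h1, rfl⟩ | ⟨h1, rfl⟩
    · exact h.adj _ h1
    · exact (h.adj _ h1).symm
  · intro e
    induction e with
    | h v w =>
      rw [SimpleGraph.mem_edgeSet, h.tree_adj, Sym2.lift_mk]
      rintro (⟨h1, rfl⟩ | ⟨h1, rfl⟩)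
      · have := h.lt v h1
        have e := up v h1
        exact ⟨by simp only [e]; omega, by simp only [e]; exact h.le v⟩
      · have := h.lt w h1
        have e := down w h1
        exact ⟨by simp only [e]; omega, by simp only [e]; exact h.le w⟩
  · intro u v w hv hw hvw
    simp only [Sym2.lift_mk]
    rcases h.tree_adj.1 hv with ⟨h1, rfl⟩ | ⟨h1, rfl⟩ <;>
      rcases h.tree_adj.1 hw with ⟨h2, h3⟩ | ⟨h2, h3⟩
    · exact absurd h3 hvw
    · subst h3
      simp only [up _ h1, down _ h2]
      exact (h.lt _ h2).ne
    · subst h3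
      simp only [up _ h2, down _ h1]
      exact (h.lt _ h1).ne'
    · have e := down w h2
      rw [h3] at e
      simp only [down _ h1, e]
      exact h.inj v w hvw h1 h2 h3.symm
  · obtain ⟨f, hs, hf⟩ := h.exists_depth
    intro v q w hq hd hw
    rw [h.tree_dist hs hf, h.tree_dist hs hf] at hd
    simp only [Sym2.lift_mk]
    rcases h.tree_adj.1 hq with ⟨h1, rfl⟩ | ⟨h1, rfl⟩
    · rw [up _ h1]
      exact le_max_left _ _
    · have := hf _ h1
      omega

/-- In each round, the number of informed vertices at most doubles. -/
theorem card_le_two_pow [Fintype V] (h : IsSchedule G s t a p) : Fintype.card V ≤ 2 ^ t := by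
  classical
  -- The source is included explicitly, since a schedule does not require `a s = 0`.
  have key : ∀ i, (Finset.univ.filter fun v => v = s ∨ a v ≤ i).card ≤ 2 ^ i := by
    intro i
    induction i with
    | zero =>
      have : (Finset.univ.filter fun v => v = s ∨ a v ≤ 0) ⊆ {s} := by
        intro v hv
        simp only [Finset.mem_filter, Finset.mem_singleton] at hv ⊢
        rcases hv.2 with h1 | h1
        · exact h1
        · by_contra h2
          have := h.lt v h2
          omega
      simpa using Finset.card_le_card this
    | succ i ih =>
      have hsub : (Finset.univ.filter fun v => v = s ∨ a v ≤ i + 1) ⊆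
          (Finset.univ.filter fun v => v = s ∨ a v ≤ i) ∪
          (Finset.univ.filter fun v => v ≠ s ∧ a v = i + 1) := by
        intro v hv
        simp only [Finset.mem_filter, Finset.mem_union, Finset.mem_univ, true_and] at hv ⊢
        by_cases hvs : v = s
        · exact Or.inl (Or.inl hvs)
        · rcases hv with h1 | h1
          · exact absurd h1 hvs
          · rcases Nat.lt_or_ge i (a v) with h2 | h2
            · exact Or.inr ⟨hvs, by omega⟩
            · exact Or.inl (Or.inr h2)
      -- Vertices informed in the same round have distinct callers, all of which were informed
      -- earlier.
      have hinj : (Finset.univ.filter fun v => v ≠ s ∧ a v = i + 1).card ≤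
          (Finset.univ.filter fun v => v = s ∨ a v ≤ i).card := by
        apply Finset.card_le_card_of_injOn p
        · intro v hv
          simp only [Finset.coe_filter, Finset.mem_univ, true_and, Set.mem_ofPred_eq] at hv ⊢
          have := h.lt v hv.1
          exact Or.inr (by omega)
        · intro v hv w hw hp
          simp only [Finset.coe_filter, Finset.mem_univ, true_and, Set.mem_ofPred_eq] at hv hw
          by_contra hne
          exact h.inj v w hne hv.1 hw.1 hp (hv.2.trans hw.2.symm)
      have h1 := Finset.card_le_card hsub
      have h2 := Finset.card_union_le (Finset.univ.filter fun v => v = s ∨ a v ≤ i)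
        (Finset.univ.filter fun v => v ≠ s ∧ a v = i + 1)
      rw [pow_succ]
      omega
  have h1 := key t
  rwa [Finset.filter_true_of_mem, Finset.card_univ] at h1
  exact fun v _ => Or.inr (h.le v)

end IsSchedule

theorem broadcastTime_le_iff {V : Type*} [Finite V] {G : SimpleGraph V} {s : V} {t : ℕ} :
    broadcastTime G s ≤ t ↔ ∃ a p, IsSchedule G s t a p := by
  constructor
  · intro h
    rw [broadcastTime] at h
    have hne : {b : ℕ∞ | ∃ t : ℕ, b = t ∧ ∃ T τ, IsBroadcastProtocol G s t T τ}.Nonempty := by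
      by_contra hne
      rw [Set.not_nonempty_iff_eq_empty] at hne
      rw [hne, sInf_empty] at h
      exact absurd h (by simp)
    obtain ⟨t', ht', T, τ, hT⟩ := csInf_mem hne
    rw [ht'] at h
    have hle : t' ≤ t := by exact_mod_cast h
    obtain ⟨a, p, hap⟩ := hT.exists_isSchedule
    exact ⟨a, p, hap.adj, hap.lt, fun v => (hap.le v).trans hle, hap.inj⟩
  · rintro ⟨a, p, h⟩
    exact sInf_le ⟨t, rfl, _, _, h.isBroadcastProtocol⟩

/-! ### Broadcasting as a constraint satisfaction problem on a tree -/

/-- The part of a schedule that is seen at a node of a tree decomposition: the times `a` and the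
callers `p` of vertices, and for each vertex `u` and each time `i` the index `q u i` of the child
subtree that contains the vertex which is informed by `u` at time `i` and is not in the bag of the
node (it is `0` if there is none). -/
structure LocalState (n : ℕ) where
  a : Fin n → ℕ
  p : Fin n → Fin n
  q : Fin n → ℕ → ℕ

namespace TreeDecomposition

open Relation

variable {n : ℕ} {G : SimpleGraph (Fin n)} (D : TreeDecomposition G)

/-- `y` is a child of `x`. -/
def IsChild (y x : Fin D.size) : Prop := y ≠ D.root ∧ D.parent y = x

/-- The position of a node among its siblings, starting with `1`. -/
def siblingIndex (y : Fin D.size) : ℕ :=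
  1 + (Finset.univ.filter fun z => z < y ∧ z ≠ D.root ∧ D.parent z = D.parent y).card

/-- The equation for `q` in `lt` says that a callee present in the bag is not attributed to a child
subtree. It excludes a second callee at the same time that has already been forgotten. -/
structure IsLocal (s : Fin n) (t : ℕ) (x : Fin D.size) (l : LocalState n) : Prop where
  adj : ∀ v ∈ D.bag x, v ≠ s → G.Adj v (l.p v)
  le : ∀ v ∈ D.bag x, l.a v ≤ t
  lt : ∀ v ∈ D.bag x, v ≠ s → l.p v ∈ D.bag x → l.a (l.p v) < l.a v ∧ l.q (l.p v) (l.a v) = 0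
  inj : ∀ v ∈ D.bag x, ∀ w ∈ D.bag x, v ≠ w → v ≠ s → w ≠ s → l.p v = l.p w → l.a v ≠ l.a w

/-- The state `l'` of the node `y` and the state `l` of its parent fit together. -/
structure IsCompatible (s : Fin n) (t : ℕ) (y : Fin D.size) (l' l : LocalState n) : Prop where
  a_eq : ∀ v ∈ D.bag y, v ∈ D.bag (D.parent y) → l'.a v = l.a v
  p_eq : ∀ v ∈ D.bag y, v ∈ D.bag (D.parent y) → l'.p v = l.p v
  q_eq : ∀ v ∈ D.bag y, v ∈ D.bag (D.parent y) → ∀ i ≤ t, l'.q v i ≠ 0 →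
    l.q v i = D.siblingIndex y
  q_new : ∀ v ∈ D.bag y, v ∉ D.bag (D.parent y) → v ≠ s → l'.p v ∈ D.bag (D.parent y) →
    l.q (l'.p v) (l'.a v) = D.siblingIndex y

theorem exists_depth : ∃ f : Fin D.size → ℕ, (∀ x y, D.IsChild y x → f y = f x + 1) ∧
    f D.root = 0 ∧ ∀ x, f x < D.size := by
  classical
  let f : Fin D.size → ℕ := fun x => Nat.find (D.reaches_root x)
  have h1 : ∀ x y, D.IsChild y x → f y = f x + 1 := by
    rintro x y ⟨hy, rfl⟩
    refine (Nat.find_eq_iff _).2 ⟨?_, ?_⟩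
    · rw [Function.iterate_succ_apply]
      exact Nat.find_spec (D.reaches_root (D.parent y))
    · intro j hj
      cases j with
      | zero => exact hy
      | succ j =>
        rw [Function.iterate_succ_apply]
        exact Nat.find_min (D.reaches_root (D.parent y)) (Nat.lt_of_succ_lt_succ hj)
  have h0 : f D.root = 0 := (Nat.find_eq_zero _).2 rfl
  refine ⟨f, h1, h0, fun x => ?_⟩
  -- The path from `x` to the root passes through all depths from `f x` down to 0, so there are at
  -- least `f x + 1` nodes.
  have key : ∀ k x, f x = k → Finset.range (k + 1) ⊆ Finset.univ.image f := by
    intro k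
    induction k with
    | zero =>
      intro x hx j hj
      have : j = 0 := by simpa using hj
      exact Finset.mem_image.2 ⟨x, Finset.mem_univ _, by rw [hx, this]⟩
    | succ k ih =>
      intro x hx j hj
      rcases Nat.lt_or_ge j (k + 1) with h | h
      · have hxr : x ≠ D.root := by
          rintro rfl
          omega
        have := h1 _ x ⟨hxr, rfl⟩
        exact ih (D.parent x) (by omega) (Finset.mem_range.2 h)
      · have : j = k + 1 := by
          have := Finset.mem_range.1 hj
          omega
        exact Finset.mem_image.2 ⟨x, Finset.mem_univ _, by rw [hx, this]⟩
  have h2 := Finset.card_le_card (key _ x rfl)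
  have h3 := Finset.card_image_le (s := Finset.univ) (f := f)
  rw [Finset.card_range] at h2
  rw [Finset.card_univ, Fintype.card_fin] at h3
  omega

variable {D}

theorem siblingIndex_ne_zero (y : Fin D.size) : D.siblingIndex y ≠ 0 := by
  rw [siblingIndex]
  omega

theorem siblingIndex_lt {x y z : Fin D.size} (hy : D.IsChild y x) (hz : D.IsChild z x)
    (h : y < z) : D.siblingIndex y < D.siblingIndex z := by
  rw [siblingIndex, siblingIndex, hy.2, hz.2]
  apply Nat.add_lt_add_left
  apply Finset.card_lt_card
  rw [Finset.ssubset_iff_of_subset]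
  · refine ⟨y, ?_, ?_⟩
    · simp only [Finset.mem_filter, Finset.mem_univ, true_and]
      exact ⟨h, hy⟩
    · simp
  · intro w
    simp only [Finset.mem_filter, Finset.mem_univ, true_and]
    exact fun hw => ⟨hw.1.trans h, hw.2⟩

theorem siblingIndex_inj {x y z : Fin D.size} (hy : D.IsChild y x) (hz : D.IsChild z x)
    (h : D.siblingIndex y = D.siblingIndex z) : y = z := by
  rcases lt_trichotomy y z with h1 | h1 | h1
  · exact absurd h (siblingIndex_lt hy hz h1).ne
  · exact h1
  · exact absurd h (siblingIndex_lt hz hy h1).ne'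

/-- Nodes of a nice decomposition have at most two children. This is why the marks `q u i` can be
coded as digits in base 3. -/
theorem IsNice.siblingIndex_le (hD : D.IsNice) {y : Fin D.size} (hy : y ≠ D.root) :
    D.siblingIndex y ≤ 2 := by
  have hmem : y ∈ D.children (D.parent y) := ⟨hy, rfl⟩
  have key : ∃ y₁ y₂, D.children (D.parent y) ⊆ {y₁, y₂} := by
    rcases hD.nodes (D.parent y) with h | ⟨z, _, h, _⟩ | ⟨z, _, h, _⟩ | ⟨z₁, z₂, _, h, _⟩
    · exact ⟨y, y, by rw [h.1]; exact Set.empty_subset _⟩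
    · exact ⟨z, z, by simp [h]⟩
    · exact ⟨z, z, by simp [h]⟩
    · exact ⟨z₁, z₂, h.le⟩
  obtain ⟨y₁, y₂, h⟩ := key
  have hsub : insert y (Finset.univ.filter fun z =>
      z < y ∧ z ≠ D.root ∧ D.parent z = D.parent y) ⊆ {y₁, y₂} := by
    intro z hz
    have hz' : z ∈ D.children (D.parent y) := by
      rcases Finset.mem_insert.1 hz with rfl | hz
      · exact hmem
      · exact (Finset.mem_filter.1 hz).2.2
    simpa using h hz'
  have h1 := Finset.card_le_card hsub
  rw [Finset.card_insert_of_notMem (by simp)] at h1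
  have h2 := Finset.card_le_two (a := y₁) (b := y₂)
  rw [siblingIndex]
  omega

theorem exists_path {v : Fin n} {x z : Fin D.size} (hx : v ∈ D.bag x) (hz : v ∈ D.bag z) :
    ReflTransGen (fun x z => v ∈ D.bag x ∧ v ∈ D.bag z ∧ (D.IsChild x z ∨ D.IsChild z x)) x z := by
  have h := (SimpleGraph.reachable_iff_reflTransGen _ _).1
    ((D.connected v).preconnected ⟨x, hx⟩ ⟨z, hz⟩)
  refine ReflTransGen.lift (f := fun x : {x | v ∈ D.bag x} => (x : Fin D.size)) ?_ _ _ h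
  rintro ⟨x, hx⟩ ⟨z, hz⟩ hxz
  refine ⟨hx, hz, ?_⟩
  rw [SimpleGraph.comap_adj, Function.Embedding.subtype_apply, Function.Embedding.subtype_apply,
    SimpleGraph.fromRel_adj] at hxz
  obtain ⟨hne, h1 | h1⟩ := hxz
  · refine Or.inl ⟨?_, h1⟩
    rintro rfl
    exact hne (D.parent_root.symm.trans h1)
  · refine Or.inr ⟨?_, h1⟩
    rintro rfl
    exact hne (h1.symm.trans D.parent_root)

/-- Two nodes whose bags contain `u` have a common ancestor that is reached from both of them
through bags that contain `u`. -/
theorem exists_meet {u : Fin n} {x z : Fin D.size} (hx : u ∈ D.bag x) (hz : u ∈ D.bag z) :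
    ∃ c, ReflTransGen (fun y x => D.IsChild y x ∧ u ∈ D.bag x) x c ∧
      ReflTransGen (fun y x => D.IsChild y x ∧ u ∈ D.bag x) z c := by
  induction exists_path hx hz using ReflTransGen.head_induction_on with
  | refl => exact ⟨z, .refl, .refl⟩
  | head h1 _ ih =>
    obtain ⟨h1, h2, h3⟩ := h1
    obtain ⟨c, hc1, hc2⟩ := ih h2
    rcases h3 with h3 | h3
    · exact ⟨c, hc1.head ⟨h3, h2⟩, hc2⟩
    -- The path first goes down to a child. If that child is the meeting node, its parent serves
    -- instead; otherwise the upward path of the child starts by returning to the parent, and this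
    -- step is dropped.
    · rcases hc1.cases_head with rfl | ⟨d, hd, hc⟩
      · exact ⟨_, .refl, hc2.tail ⟨h3, h1⟩⟩
      · rw [← hd.1.2, h3.2] at hc
        exact ⟨c, hc, hc2⟩

/-! ### From compatible local states to a schedule -/

section Soundness

variable {s : Fin n} {t : ℕ} {st : Fin D.size → LocalState n}

theorem state_eq_of_mem (hC : ∀ y, y ≠ D.root → D.IsCompatible s t y (st y) (st (D.parent y)))
    {v : Fin n} {x z : Fin D.size} (hx : v ∈ D.bag x) (hz : v ∈ D.bag z) :
    (st x).a v = (st z).a v ∧ (st x).p v = (st z).p v := by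
  induction exists_path hx hz using ReflTransGen.head_induction_on with
  | refl => exact ⟨rfl, rfl⟩
  | head h1 _ ih =>
    obtain ⟨h1, h2, ⟨h3, rfl⟩ | ⟨h3, rfl⟩⟩ := h1
    · have := hC _ h3
      exact ⟨(this.a_eq _ h1 h2).trans (ih h2).1, (this.p_eq _ h1 h2).trans (ih h2).2⟩
    · have := hC _ h3
      exact ⟨(this.a_eq _ h2 h1).symm.trans (ih h2).1, (this.p_eq _ h2 h1).symm.trans (ih h2).2⟩

/-- The trace of a call from `u` to `v` on the way up: `q_new` sets the mark when `v` leaves the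
bag, and `q_eq` hands an existing mark on to the parent. Sibling indices are nonzero, so a mark is
never mistaken for the absence of one. -/
theorem mem_or_state_eq (hC : ∀ y, y ≠ D.root → D.IsCompatible s t y (st y) (st (D.parent y)))
    {u v : Fin n} {i : ℕ} (hi : i ≤ t) (hv : v ≠ s)
    (hp : ∀ x, v ∈ D.bag x → (st x).p v = u ∧ (st x).a v = i) {x z : Fin D.size}
    (hx : v ∈ D.bag x) (hux : u ∈ D.bag x)
    (h : ReflTransGen (fun y x => D.IsChild y x ∧ u ∈ D.bag x) x z) :
    u ∈ D.bag z ∧ ∀ c, D.IsChild z c → u ∈ D.bag c → v ∈ D.bag c ∨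
      (st c).q u i = D.siblingIndex z := by
  have step : ∀ y, y ≠ D.root → u ∈ D.bag y → u ∈ D.bag (D.parent y) →
      (v ∈ D.bag y ∨ (st y).q u i ≠ 0) →
      v ∈ D.bag (D.parent y) ∨ (st (D.parent y)).q u i = D.siblingIndex y := by
    intro y hy h1 h2 h3
    by_cases hvp : v ∈ D.bag (D.parent y)
    · exact Or.inl hvp
    right
    rcases h3 with h3 | h3
    · have := (hC y hy).q_new v h3 hvp hv
      rw [(hp y h3).1, (hp y h3).2] at this
      exact this h2
    · exact (hC y hy).q_eq u h1 h2 i hi h3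
  induction h with
  | refl =>
    refine ⟨hux, ?_⟩
    rintro _ ⟨hr, rfl⟩ h2
    exact step x hr hux h2 (Or.inl hx)
  | tail _ hbc ih =>
    refine ⟨hbc.2, ?_⟩
    rintro _ ⟨hr, rfl⟩ h2
    refine step _ hr hbc.2 h2 ?_
    rcases ih.2 _ hbc.1 hbc.2 with h | h
    · exact Or.inl h
    · exact Or.inr (h ▸ siblingIndex_ne_zero _)

theorem exists_isSchedule_of_states (hL : ∀ x, D.IsLocal s t x (st x))
    (hC : ∀ y, y ≠ D.root → D.IsCompatible s t y (st y) (st (D.parent y))) :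
    ∃ a p, IsSchedule G s t a p := by
  choose X hX using D.vertex_covered
  have ha : ∀ v x, v ∈ D.bag x → (st x).a v = (st (X v)).a v :=
    fun v x hx => (state_eq_of_mem hC hx (hX v)).1
  have hp : ∀ v x, v ∈ D.bag x → (st x).p v = (st (X v)).p v :=
    fun v x hx => (state_eq_of_mem hC hx (hX v)).2
  have hadj : ∀ v, v ≠ s → G.Adj v ((st (X v)).p v) := fun v hv => (hL (X v)).adj v (hX v) hv
  refine ⟨fun v => (st (X v)).a v, fun v => (st (X v)).p v, hadj, ?_, ?_, ?_⟩
  · intro v hv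
    obtain ⟨x, h1, h2⟩ := D.edge_covered _ _ (hadj v hv)
    rw [← hp v x h1] at h2
    have h3 := ((hL x).lt v h1 hv h2).1
    rw [ha v x h1, ha _ x h2, hp v x h1] at h3
    exact h3
  · exact fun v => (hL (X v)).le v (hX v)
  · intro v w hvw hv hw hpp haa
    obtain ⟨x, hx1, hx2⟩ := D.edge_covered _ _ (hadj v hv)
    obtain ⟨z, hz1, hz2⟩ := D.edge_covered _ _ (hadj w hw)
    generalize hi : (st (X v)).a v = i at haa
    generalize hu : (st (X v)).p v = u at hpp hx2
    rw [← hpp] at hz2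
    have hit : i ≤ t := hi ▸ (hL (X v)).le v (hX v)
    have hv' : ∀ x, v ∈ D.bag x → (st x).p v = u ∧ (st x).a v = i :=
      fun x hx => ⟨(hp v x hx).trans hu, (ha v x hx).trans hi⟩
    have hw' : ∀ x, w ∈ D.bag x → (st x).p w = u ∧ (st x).a w = i :=
      fun x hx => ⟨(hp w x hx).trans hpp.symm, (ha w x hx).trans haa.symm⟩
    have hzero : ∀ v', v' ≠ s → (∀ x, v' ∈ D.bag x → (st x).p v' = u ∧ (st x).a v' = i) →
        ∀ c, v' ∈ D.bag c → u ∈ D.bag c → (st c).q u i = 0 := by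
      intro v' hs hv' c h1 h2
      have := (hL c).lt v' h1 hs
      rw [(hv' c h1).1, (hv' c h1).2] at this
      exact (this h2).2
    have hboth : ∀ c, v ∈ D.bag c → w ∈ D.bag c → False := fun c h1 h2 =>
      (hL c).inj v h1 w h2 hvw hv hw ((hv' c h1).1.trans (hw' c h2).1.symm)
        ((hv' c h1).2.trans (hw' c h2).2.symm)
    obtain ⟨c, hxc, hzc⟩ := exists_meet hx2 hz2
    have hcu := (mem_or_state_eq hC hit hv hv' hx1 hx2 hxc).1
    -- At the meeting node each callee is in the bag or marked. Two callees in the bag contradict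
    -- `inj`; one in the bag makes the mark 0, contradicting the mark of the other; two marks agree
    -- only if both paths arrive through the same child, and then that child is a lower meeting
    -- node.
    induction hxc with
    | refl =>
      rcases hzc.cases_tail with rfl | ⟨d, hd, hdc⟩
      · exact hboth _ hx1 hz1
      · rcases (mem_or_state_eq hC hit hw hw' hz1 hz2 hd).2 _ hdc.1 hx2 with h | h
        · exact hboth _ hx1 h
        · exact siblingIndex_ne_zero d (h.symm.trans (hzero v hv hv' _ hx1 hx2))
    | @tail b c hb hbc ih =>
      have h1 := (mem_or_state_eq hC hit hv hv' hx1 hx2 hb).2 c hbc.1 hcu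
      rcases hzc.cases_tail with rfl | ⟨d, hd, hdc⟩
      · rcases h1 with h1 | h1
        · exact hboth _ h1 hz1
        · exact siblingIndex_ne_zero b (h1.symm.trans (hzero w hw hw' _ hz1 hz2))
      · have h2 := (mem_or_state_eq hC hit hw hw' hz1 hz2 hd).2 c hdc.1 hcu
        rcases h1 with h1 | h1 <;> rcases h2 with h2 | h2
        · exact hboth _ h1 h2
        · exact siblingIndex_ne_zero d (h2.symm.trans (hzero v hv hv' _ h1 hcu))
        · exact siblingIndex_ne_zero b (h1.symm.trans (hzero w hw hw' _ h2 hcu))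
        · have := siblingIndex_inj hbc.1 hdc.1 (h1.symm.trans h2)
          subst this
          exact ih hd (mem_or_state_eq hC hit hv hv' hx1 hx2 hb).1

end Soundness

/-! ### From a schedule to compatible local states -/

section Completeness

/-- The vertex `v` occurs in a bag of the subtree at `y`. -/
def Below (v : Fin n) (y : Fin D.size) : Prop := ∃ z, v ∈ D.bag z ∧ ReflTransGen D.IsChild z y

/-- The bags containing `v` are connected, and the subtree of `y` can only be left through `x`,
whose bag does not contain `v`. -/
theorem reflTransGen_of_below {v : Fin n} {x y z : Fin D.size} (hy : D.IsChild y x)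
    (hv : v ∉ D.bag x) (h : Below v y) (hz : v ∈ D.bag z) : ReflTransGen D.IsChild z y := by
  obtain ⟨w, hw, hwy⟩ := h
  induction exists_path hw hz with
  | refl => exact hwy
  | tail _ h ih =>
    obtain ⟨h1, h2, h3⟩ := h
    have ih := ih h1
    rcases h3 with h3 | h3
    · rcases ih.cases_head with rfl | ⟨d, hd, hdy⟩
      · rw [← h3.2, hy.2] at h2
        exact absurd h2 hv
      · rwa [← hd.2, h3.2] at hdy
    · exact ih.head h3

theorem eq_or_depth_lt {f : Fin D.size → ℕ} (hf : ∀ x y, D.IsChild y x → f y = f x + 1)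
    {y z : Fin D.size} (h : ReflTransGen D.IsChild z y) : z = y ∨ f y < f z := by
  induction h with
  | refl => exact Or.inl rfl
  | tail _ h ih =>
    have := hf _ _ h
    rcases ih with rfl | ih <;> right <;> omega

/-- A node whose bag contains `v` lies below both children. Two ancestors of one node are
comparable, and siblings have equal depth, so they coincide. -/
theorem below_unique {v : Fin n} {x y y' : Fin D.size} (hy : D.IsChild y x) (hy' : D.IsChild y' x)
    (hv : v ∉ D.bag x) (h : Below v y) (h' : Below v y') : y = y' := by
  obtain ⟨z, hz, hzy⟩ := h'
  have key := reflTransGen_of_below hy hv h hz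
  obtain ⟨f, hf, -, -⟩ := D.exists_depth
  have hu : Relator.RightUnique D.IsChild := fun a b c h1 h2 => h1.2.symm.trans h2.2
  have e1 := hf _ _ hy
  have e2 := hf _ _ hy'
  rcases ReflTransGen.total_of_right_unique hu key hzy with h | h <;>
    rcases eq_or_depth_lt hf h with h | h
  · exact h
  · omega
  · exact h.symm
  · omega

open Classical in
/-- The states that belong to a schedule. -/
noncomputable def stateOf (D : TreeDecomposition G) (s : Fin n) (a : Fin n → ℕ)
    (p : Fin n → Fin n) (x : Fin D.size) : LocalState n where
  a := a
  p := p
  q u i := if h : ∃ y v, D.IsChild y x ∧ v ∉ D.bag x ∧ Below v y ∧ v ≠ s ∧ p v = u ∧ a v = i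
    then D.siblingIndex h.choose else 0

variable {s : Fin n} {t : ℕ} {a : Fin n → ℕ} {p : Fin n → Fin n}

/-- The choice in `stateOf` is immaterial: caller and time determine the callee, and the callee
determines the child by `below_unique`. -/
theorem stateOf_q_eq (h : IsSchedule G s t a p) {x y : Fin D.size} {v : Fin n}
    (hy : D.IsChild y x) (hvx : v ∉ D.bag x) (hvy : Below v y) (hv : v ≠ s) :
    (stateOf D s a p x).q (p v) (a v) = D.siblingIndex y := by
  have hex : ∃ y v', D.IsChild y x ∧ v' ∉ D.bag x ∧ Below v' y ∧ v' ≠ s ∧ p v' = p v ∧ a v' = a v :=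
    ⟨y, v, hy, hvx, hvy, hv, rfl, rfl⟩
  simp only [stateOf]
  rw [dif_pos hex]
  obtain ⟨v', h1, h2, h3, h4, h5, h6⟩ := hex.choose_spec
  have : v' = v := by
    by_contra hne
    exact h.inj v' v hne h4 hv h5 h6
  subst this
  rw [below_unique h1 hy h2 h3 hvy]

theorem isLocal_stateOf (h : IsSchedule G s t a p) (x : Fin D.size) :
    D.IsLocal s t x (stateOf D s a p x) where
  adj v _ hv := h.adj v hv
  le v _ := h.le v
  lt v hvx hv _ := by
    refine ⟨h.lt v hv, ?_⟩
    simp only [stateOf]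
    rw [dif_neg]
    rintro ⟨y, v', h1, h2, h3, h4, h5, h6⟩
    have : v' = v := by
      by_contra hne
      exact h.inj v' v hne h4 hv h5 h6
    exact h2 (this ▸ hvx)
  inj v _ w _ := h.inj v w

theorem isCompatible_stateOf (h : IsSchedule G s t a p) {y : Fin D.size} (hy : y ≠ D.root) :
    D.IsCompatible s t y (stateOf D s a p y) (stateOf D s a p (D.parent y)) where
  a_eq _ _ _ := rfl
  p_eq _ _ _ := rfl
  q_eq u hu hu' i _ hq := by
    simp only [stateOf, ne_eq, dite_eq_right_iff, not_forall] at hq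
    obtain ⟨⟨z, v, h1, h2, h3, h4, rfl, rfl⟩, -⟩ := hq
    obtain ⟨c, hc, hcz⟩ := h3
    have hvy : Below v y := ⟨c, hc, hcz.tail h1⟩
    refine stateOf_q_eq h ⟨hy, rfl⟩ (fun hv => ?_) hvy h4
    -- If `v` were in the bag of `D.parent y`, that node would be a descendant of its own grandchild
    -- `z`.
    obtain ⟨f, hf, -, -⟩ := D.exists_depth
    have e1 := hf _ _ h1
    have e2 := hf _ y ⟨hy, rfl⟩
    rcases eq_or_depth_lt hf (reflTransGen_of_below h1 h2 ⟨c, hc, hcz⟩ hv) with e | e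
    · rw [e] at e2
      omega
    · omega
  q_new v hvy hvx hv _ := stateOf_q_eq h ⟨hy, rfl⟩ hvx ⟨y, hvy, .refl⟩ hv

theorem stateOf_q_le (hD : D.IsNice) (x : Fin D.size) (u : Fin n) (i : ℕ) :
    (stateOf D s a p x).q u i ≤ 2 := by
  simp only [stateOf]
  split_ifs with h
  · exact hD.siblingIndex_le h.choose_spec.choose_spec.1.1
  · exact Nat.zero_le _

end Completeness

end TreeDecomposition

namespace TreeDecomposition

variable {n : ℕ} {G : SimpleGraph (Fin n)} {D : TreeDecomposition G}

/-! ### Constraint satisfaction bottom up -/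

/-- The state `σ` of `x` extends to the nodes less than `r` levels below `x` such that they
satisfy the constraints `L` on states and `C` on pairs of states of nodes and their parents. -/
def Alive (D : TreeDecomposition G) {S : Type*} (L : Fin D.size → S → Prop)
    (C : Fin D.size → S → S → Prop) : ℕ → Fin D.size → S → Prop
  | 0, _, _ => True
  | r + 1, x, σ => L x σ ∧ ∀ y, D.IsChild y x → ∃ σ', C y σ' σ ∧ Alive D L C r y σ'

/-- Constraints only link a node to its parent, so the states of different children can be chosen
independently. All depths are less than `D.size`, so that many levels cover the whole tree. -/
theorem exists_alive_iff {S : Type*} {L : Fin D.size → S → Prop} {C : Fin D.size → S → S → Prop} :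
    (∃ σ, D.Alive L C D.size D.root σ) ↔ ∃ st : Fin D.size → S,
      (∀ x, L x (st x)) ∧ ∀ y, y ≠ D.root → C y (st y) (st (D.parent y)) := by
  classical
  obtain ⟨f, hf, hf0, hfN⟩ := D.exists_depth
  constructor
  · rintro ⟨σ, hσ⟩
    -- States are fixed level by level from the root; a node at depth `k + 1` takes the witness
    -- supplied by its parent being alive. Values at deeper nodes are placeholders.
    have key : ∀ k, ∃ st : Fin D.size → S, ∀ x, f x ≤ k →
        D.Alive L C (D.size - f x) x (st x) ∧ (x ≠ D.root → C x (st x) (st (D.parent x))) := by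
      intro k
      induction k with
      | zero =>
        refine ⟨fun _ => σ, fun x hx => ?_⟩
        have hxr : x = D.root := by
          by_contra h
          have := hf _ x ⟨h, rfl⟩
          omega
        subst hxr
        exact ⟨by rw [hf0]; exact hσ, fun h => absurd rfl h⟩
      | succ k ih =>
        obtain ⟨st, hst⟩ := ih
        have hex : ∀ x, ∃ σ', f x = k + 1 →
            C x σ' (st (D.parent x)) ∧ D.Alive L C (D.size - f x) x σ' := by
          intro x
          by_cases hx : f x = k + 1
          · have hxr : x ≠ D.root := by
              rintro rfl
              omega
            have h1 := hf _ x ⟨hxr, rfl⟩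
            have h2 := (hst (D.parent x) (by omega)).1
            obtain ⟨m, hm⟩ : ∃ m, D.size - f (D.parent x) = m + 1 := ⟨D.size - f x, by
              have := hfN x
              omega⟩
            rw [hm] at h2
            obtain ⟨σ', h3, h4⟩ := h2.2 x ⟨hxr, rfl⟩
            refine ⟨σ', fun _ => ⟨h3, ?_⟩⟩
            rwa [show D.size - f x = m by omega]
          · exact ⟨σ, fun h => absurd h hx⟩
        choose g hg using hex
        refine ⟨fun x => if f x = k + 1 then g x else st x, fun x hx => ?_⟩
        have hpar : x ≠ D.root → f (D.parent x) ≠ k + 1 := by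
          intro hxr
          have := hf _ x ⟨hxr, rfl⟩
          omega
        by_cases hxk : f x = k + 1
        · simp only [hxk, if_true]
          refine ⟨hxk ▸ (hg x hxk).2, fun hxr => ?_⟩
          rw [if_neg (hpar hxr)]
          exact (hg x hxk).1
        · simp only [hxk, if_false]
          refine ⟨(hst x (by omega)).1, fun hxr => ?_⟩
          rw [if_neg (hpar hxr)]
          exact (hst x (by omega)).2 hxr
    obtain ⟨st, hst⟩ := key D.size
    refine ⟨st, fun x => ?_, fun y hy => (hst y (hfN y).le).2 hy⟩
    have h := (hst x (hfN x).le).1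
    obtain ⟨m, hm⟩ : ∃ m, D.size - f x = m + 1 := ⟨D.size - f x - 1, by
      have := hfN x
      omega⟩
    rw [hm] at h
    exact h.1
  · rintro ⟨st, hL, hC⟩
    have key : ∀ r x, D.Alive L C r x (st x) := by
      intro r
      induction r with
      | zero => exact fun _ => trivial
      | succ r ih =>
        refine fun x => ⟨hL x, ?_⟩
        rintro y ⟨hy, rfl⟩
        exact ⟨st y, hC y hy, ih y⟩
    exact ⟨_, key _ _⟩

/-! ### Numbers as states -/

theorem _root_.Nat.exists_digits_eq (b k : ℕ) (f : ℕ → ℕ) (hf : ∀ i < k, f i < b) :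
    ∃ x < b ^ k, ∀ i < k, x / b ^ i % b = f i := by
  induction k generalizing f with
  | zero => exact ⟨0, by simp, by simp⟩
  | succ k ih =>
    obtain ⟨x, hx, hd⟩ := ih (fun i => f (i + 1)) fun i hi => hf (i + 1) (by omega)
    have h0 := hf 0 (by omega)
    refine ⟨f 0 + b * x, ?_, fun i hi => ?_⟩
    · calc f 0 + b * x < b * (x + 1) := by rw [Nat.mul_add, Nat.mul_one]; omega
        _ ≤ b * b ^ k := Nat.mul_le_mul_left _ hx
        _ = b ^ (k + 1) := by ring
    · cases i with
      | zero => rw [pow_zero, Nat.div_one, Nat.add_mul_mod_self_left, Nat.mod_eq_of_lt h0]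
      | succ i =>
        rw [pow_succ', ← Nat.div_div_eq_div_mul, Nat.add_mul_div_left _ _ (by omega),
          Nat.div_eq_of_lt h0, Nat.zero_add]
        exact hd i (by omega)

/-- The number of vertices of the bag that come before `v`. -/
def rank (D : TreeDecomposition G) (x : Fin D.size) (v : Fin n) : ℕ :=
  ((D.bag x).filter (· < v)).card

theorem rank_lt {x : Fin D.size} {v : Fin n} (hv : v ∈ D.bag x) : D.rank x v < (D.bag x).card := by
  apply Finset.card_lt_card
  rw [Finset.ssubset_iff_of_subset (Finset.filter_subset _ _)]
  exact ⟨v, hv, by simp⟩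

theorem rank_lt_rank {x : Fin D.size} {v w : Fin n} (hv : v ∈ D.bag x) (h : v < w) :
    D.rank x v < D.rank x w := by
  apply Finset.card_lt_card
  rw [Finset.ssubset_iff_of_subset]
  · exact ⟨v, by simp [hv, h], by simp⟩
  · intro u
    simp only [Finset.mem_filter]
    exact fun hu => ⟨hu.1, hu.2.trans h⟩

theorem rank_inj {x : Fin D.size} {v w : Fin n} (hv : v ∈ D.bag x) (hw : w ∈ D.bag x)
    (h : D.rank x v = D.rank x w) : v = w := by
  rcases lt_trichotomy v w with h1 | h1 | h1
  · exact absurd h (rank_lt_rank hv h1).ne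
  · exact h1
  · exact absurd h (rank_lt_rank hw h1).ne'

/-- The number of possible records (the time, the caller, and the numbers `q u i`) of a vertex. -/
def numRecords (n t : ℕ) : ℕ := (t + 1) * n * 3 ^ (t + 1)

/-- The record of a vertex in a state that is given by a number. -/
def record (D : TreeDecomposition G) (t : ℕ) (x : Fin D.size) (σ : ℕ) (v : Fin n) : ℕ :=
  σ / numRecords n t ^ D.rank x v % numRecords n t

/-- The state of `x` that is given by a number. -/
def decode (D : TreeDecomposition G) (t : ℕ) (x : Fin D.size) (σ : ℕ) : LocalState n where
  a v := D.record t x σ v % (t + 1)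
  p v := ⟨D.record t x σ v / (t + 1) % n, Nat.mod_lt _ v.pos⟩
  q v i := D.record t x σ v / ((t + 1) * n) / 3 ^ i % 3

theorem decode_a_le (t : ℕ) (x : Fin D.size) (σ : ℕ) (v : Fin n) : (D.decode t x σ).a v ≤ t :=
  Nat.le_of_lt_succ (Nat.mod_lt _ (Nat.succ_pos t))

/-- Two states that agree on a bag (at all times up to `t`). -/
structure AgreeOn (b : Finset (Fin n)) (t : ℕ) (l l' : LocalState n) : Prop where
  a : ∀ v ∈ b, l.a v = l'.a v
  p : ∀ v ∈ b, l.p v = l'.p v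
  q : ∀ v ∈ b, ∀ i ≤ t, l.q v i = l'.q v i

/-- Vertices of the bag have distinct ranks, hence separate digits in base `numRecords n t`, and
each digit is a record in mixed radix. Data outside the bag or after time `t` are lost, which is why
only `AgreeOn` is claimed. -/
theorem exists_decode (hn : 0 < n) (t W : ℕ) (x : Fin D.size) (hW : (D.bag x).card ≤ W) (l : LocalState n)
    (ha : ∀ v, l.a v ≤ t) (hq : ∀ v i, l.q v i ≤ 2) :
    ∃ σ < numRecords n t ^ W, AgreeOn (D.bag x) t (D.decode t x σ) l := by
  classical
  have hrec : ∀ v, ∃ c < numRecords n t, c % (t + 1) = l.a v ∧ c / (t + 1) % n = l.p v ∧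
      ∀ i ≤ t, c / ((t + 1) * n) / 3 ^ i % 3 = l.q v i := by
    intro v
    obtain ⟨z, hz, hd⟩ := Nat.exists_digits_eq 3 (t + 1) (l.q v)
      fun i _ => Nat.lt_of_le_of_lt (hq v i) (by norm_num)
    have h1 := ha v
    have h2 := (l.p v).isLt
    have e1 : (l.a v + (t + 1) * (l.p v + n * z)) / (t + 1) = l.p v + n * z := by
      rw [Nat.add_mul_div_left _ _ (Nat.succ_pos t), Nat.div_eq_of_lt (by omega), Nat.zero_add]
    have e2 : (l.p v + n * z) / n = z := by
      rw [Nat.add_mul_div_left _ _ v.pos, Nat.div_eq_of_lt h2, Nat.zero_add]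
    refine ⟨l.a v + (t + 1) * (l.p v + n * z), ?_, ?_, ?_, ?_⟩
    · have h3 : l.p v + n * z + 1 ≤ n * 3 ^ (t + 1) := calc
        l.p v + n * z + 1 ≤ n * (z + 1) := by rw [Nat.mul_add, Nat.mul_one]; omega
        _ ≤ _ := Nat.mul_le_mul_left _ hz
      calc l.a v + (t + 1) * (l.p v + n * z) < (t + 1) * (l.p v + n * z + 1) := by
            rw [Nat.mul_add _ _ 1, Nat.mul_one]; omega
        _ ≤ (t + 1) * (n * 3 ^ (t + 1)) := Nat.mul_le_mul_left _ h3
        _ = numRecords n t := by rw [numRecords, Nat.mul_assoc]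
    · rw [Nat.add_mul_mod_self_left, Nat.mod_eq_of_lt (by omega)]
    · rw [e1, Nat.add_mul_mod_self_left, Nat.mod_eq_of_lt h2]
    · intro i hi
      rw [← Nat.div_div_eq_div_mul, e1, e2]
      exact hd i (by omega)
  choose c hc hca hcp hcq using hrec
  have hfun : ∀ i, ∃ d, (i < W → d < numRecords n t) ∧ ∀ v ∈ D.bag x, D.rank x v = i → d = c v := by
    intro i
    by_cases h : ∃ v ∈ D.bag x, D.rank x v = i
    · obtain ⟨v, hv, rfl⟩ := h
      exact ⟨c v, fun _ => hc v, fun w hw h => by rw [rank_inj hw hv h]⟩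
    · exact ⟨0, fun _ => Nat.mul_pos (Nat.mul_pos (Nat.succ_pos t) hn) (by positivity),
        fun v hv hvi => absurd ⟨v, hv, hvi⟩ h⟩
  choose d hd hdc using hfun
  obtain ⟨σ, hσ, hσd⟩ := Nat.exists_digits_eq (numRecords n t) W d hd
  have hr : ∀ v ∈ D.bag x, D.record t x σ v = c v := by
    intro v hv
    rw [record, hσd _ (lt_of_lt_of_le (rank_lt hv) hW), hdc _ v hv rfl]
  refine ⟨σ, hσ, ?_, ?_, ?_⟩
  · intro v hv
    simp only [decode]
    rw [hr v hv, hca]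
  · intro v hv
    simp only [decode]
    rw [Fin.ext_iff]
    simp only
    rw [hr v hv, hcp]
  · intro v hv i hi
    simp only [decode]
    rw [hr v hv, hcq v i hi]

theorem IsLocal.congr {s : Fin n} {t : ℕ} {x : Fin D.size} {l l' : LocalState n}
    (h : D.IsLocal s t x l) (hl : AgreeOn (D.bag x) t l' l) : D.IsLocal s t x l' where
  adj v hv hvs := by rw [hl.p v hv]; exact h.adj v hv hvs
  le v hv := by rw [hl.a v hv]; exact h.le v hv
  lt v hv hvs hp := by
    rw [hl.p v hv] at hp ⊢
    rw [hl.a v hv, hl.a _ hp, hl.q _ hp _ (h.le v hv)]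
    exact h.lt v hv hvs hp
  inj v hv w hw h1 h2 h3 h4 := by
    rw [hl.p v hv, hl.p w hw] at h4
    rw [hl.a v hv, hl.a w hw]
    exact h.inj v hv w hw h1 h2 h3 h4

/-- The bound `hkt` is needed because `q_new` reads `q` at the time `k.a v`, and agreement of `q` is
only known up to `t`. -/
theorem IsCompatible.congr {s : Fin n} {t : ℕ} {y : Fin D.size} {k k' l l' : LocalState n}
    (h : D.IsCompatible s t y k l) (hk : AgreeOn (D.bag y) t k' k)
    (hl : AgreeOn (D.bag (D.parent y)) t l' l) (hkt : ∀ v ∈ D.bag y, k.a v ≤ t) :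
    D.IsCompatible s t y k' l' where
  a_eq v h1 h2 := by rw [hk.a v h1, hl.a v h2]; exact h.a_eq v h1 h2
  p_eq v h1 h2 := by rw [hk.p v h1, hl.p v h2]; exact h.p_eq v h1 h2
  q_eq v h1 h2 i hi hq := by
    rw [hk.q v h1 i hi] at hq
    rw [hl.q v h2 i hi]
    exact h.q_eq v h1 h2 i hi hq
  q_new v h1 h2 h3 h4 := by
    rw [hk.p v h1] at h4 ⊢
    rw [hk.a v h1, hl.q _ h4 _ (hkt v h1)]
    exact h.q_new v h1 h2 h3 h4

/-- The correctness of the dynamic program. -/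
theorem exists_alive_decode_iff (hD : D.IsNice) (s : Fin n) (t W : ℕ)
    (hW : ∀ x, (D.bag x).card ≤ W) :
    (∃ σ, D.Alive (fun x (σ : Fin (numRecords n t ^ W)) => D.IsLocal s t x (D.decode t x σ))
      (fun y σ' σ => D.IsCompatible s t y (D.decode t y σ') (D.decode t (D.parent y) σ))
      D.size D.root σ) ↔ ∃ a p, IsSchedule G s t a p := by
  rw [exists_alive_iff]
  constructor
  · rintro ⟨st, h1, h2⟩
    exact exists_isSchedule_of_states (st := fun x => D.decode t x (st x)) h1 h2
  · rintro ⟨a, p, h⟩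
    have hex := fun x => exists_decode s.pos t W x (hW x) (stateOf D s a p x) h.le
      (stateOf_q_le hD x)
    choose σ hσ hag using hex
    refine ⟨fun x => ⟨σ x, hσ x⟩, fun x => (isLocal_stateOf h x).congr (hag x), fun y hy => ?_⟩
    exact (isCompatible_stateOf h hy).congr (hag y) (hag _) fun v _ => h.le v

end TreeDecomposition

/-! ### Arithmetic expressions with bounded iteration, and their compilation -/

namespace RAM

/-- Extend an environment by a value for the variable `0`. -/
def push (a : ℕ) (v : ℕ → ℕ) : ℕ → ℕ
  | 0 => a
  | i + 1 => v i

@[simp] theorem push_zero (a : ℕ) (v : ℕ → ℕ) : push a v 0 = a := rfl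
@[simp] theorem push_succ (a : ℕ) (v : ℕ → ℕ) (i : ℕ) : push a v (i + 1) = v i := rfl
@[simp] theorem push_one (a : ℕ) (v : ℕ → ℕ) : push a v 1 = v 0 := rfl

/-- Expressions over variables (de Bruijn indices) and the memory.  In `iter k a b`, the body `b` is
evaluated `k` times; it sees the accumulator, which starts with `a`, as variable `0` and the number
of previous evaluations as variable `1`. -/
inductive Expr where
  | var (i : ℕ)
  | const (c : ℕ)
  | add (a b : Expr)
  | sub (a b : Expr)
  | load (a : Expr)
  | ite (c a b : Expr)
  | iter (k a b : Expr)
  | rename (ρ : ℕ → ℕ) (a : Expr)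

namespace Expr

/-- The value of an expression, for the memory `m` and the environment `v`. -/
def eval (m : ℕ → ℕ) : Expr → (ℕ → ℕ) → ℕ
  | var i, v => v i
  | const c, _ => c
  | add a b, v => eval m a v + eval m b v
  | sub a b, v => eval m a v - eval m b v
  | load a, v => m (eval m a v)
  | ite c a b, v => if eval m c v ≠ 0 then eval m a v else eval m b v
  | iter k a b, v =>
      Nat.rec (eval m a v) (fun i r => eval m b (push r (push i v))) (eval m k v)
  | rename ρ a, v => eval m a fun i => v (ρ i)

/-- No loop that is run in the evaluation has more than `X` rounds. -/
def Fits (X : ℕ) (m : ℕ → ℕ) : Expr → (ℕ → ℕ) → Prop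
  | var _, _ => True
  | const _, _ => True
  | add a b, v => Fits X m a v ∧ Fits X m b v
  | sub a b, v => Fits X m a v ∧ Fits X m b v
  | load a, v => Fits X m a v
  | ite c a b, v => Fits X m c v ∧ (eval m c v ≠ 0 → Fits X m a v) ∧ (eval m c v = 0 → Fits X m b v)
  | iter k a b, v => Fits X m k v ∧ Fits X m a v ∧ eval m k v ≤ X ∧
      ∀ i < eval m k v, Fits X m b (push (eval m (iter (const i) a b) v) (push i v))
  | rename ρ a, v => Fits X m a fun i => v (ρ i)

/-- A bound on the running time if every loop has at most `X` rounds. -/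
def time (X : ℕ) : Expr → ℕ
  | var _ => 2
  | const _ => 1
  | add a b => time X a + time X b + 1
  | sub a b => time X a + time X b + 1
  | load a => time X a + 1
  | ite c a b => time X c + (time X a + time X b + 1)
  | iter k a b => time X k + (time X a + (1 + (1 + ((X * (time X b + 5) + 1) + 2))))
  | rename _ a => time X a

/-- Machine code for an expression, where the variable `i` is held in the register `ρ i`.  The
result is put into the register `d`, and only registers from `d` on are used. -/
def compile : Expr → (ℕ → ℕ) → ℕ → Program
  | var i, ρ, d => .seq (.const d 0) (.add d d (ρ i))
  | const c, _, d => .const d c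
  | add a b, ρ, d => .seq (.seq (compile a ρ d) (compile b ρ (d + 1))) (.add d d (d + 1))
  | sub a b, ρ, d => .seq (.seq (compile a ρ d) (compile b ρ (d + 1))) (.sub d d (d + 1))
  | load a, ρ, d => .seq (compile a ρ d) (.load d d)
  | ite c a b, ρ, d => .seq (compile c ρ d) (.ifNonzero d (compile a ρ d) (compile b ρ d))
  | iter k a b, ρ, d =>
      .seq (compile k ρ d) <| .seq (compile a ρ (d + 1)) <| .seq (.const (d + 2) 0) <|
      .seq (.const (d + 3) 1) <| .seq
        (.whileNonzero d <|
          .seq (compile b (push (d + 1) (push (d + 2) ρ)) (d + 4)) <|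
          .seq (.seq (.const (d + 1) 0) (.add (d + 1) (d + 1) (d + 4))) <|
          .seq (.add (d + 2) (d + 2) (d + 3)) (.sub d d (d + 3)))
        (.seq (.const d 0) (.add d d (d + 1)))
  | rename ρ' a, ρ, d => compile a (fun i => ρ (ρ' i)) d

end Expr

/-- `P` leads from `σ` to `σ'` in at most `B` steps. -/
def Runs (P : Program) (σ : State) (B : ℕ) (σ' : State) : Prop := ∃ k ≤ B, Exec P σ k σ'

theorem Runs.mono {P : Program} {σ σ' : State} {B B' : ℕ} (h : Runs P σ B σ') (hB : B ≤ B') :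
    Runs P σ B' σ' := by
  obtain ⟨k, hk, h⟩ := h
  exact ⟨k, hk.trans hB, h⟩

theorem Runs.seq {P Q : Program} {σ σ' σ'' : State} {B C : ℕ} (h : Runs P σ B σ')
    (h' : Runs Q σ' C σ'') : Runs (.seq P Q) σ (B + C) σ'' := by
  obtain ⟨k, hk, h⟩ := h
  obtain ⟨l, hl, h'⟩ := h'
  exact ⟨k + l, Nat.add_le_add hk hl, h.seq h'⟩

theorem Runs.const (x c : ℕ) (σ : State) :
    Runs (.const x c) σ 1 { σ with reg := Function.update σ.reg x c } := ⟨1, le_rfl, .const x c σ⟩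

theorem Runs.add (x y z : ℕ) (σ : State) :
    Runs (.add x y z) σ 1 { σ with reg := Function.update σ.reg x (σ.reg y + σ.reg z) } :=
  ⟨1, le_rfl, .add x y z σ⟩

theorem Runs.sub (x y z : ℕ) (σ : State) :
    Runs (.sub x y z) σ 1 { σ with reg := Function.update σ.reg x (σ.reg y - σ.reg z) } :=
  ⟨1, le_rfl, .sub x y z σ⟩

theorem Runs.load (x y : ℕ) (σ : State) :
    Runs (.load x y) σ 1 { σ with reg := Function.update σ.reg x (σ.mem (σ.reg y)) } :=
  ⟨1, le_rfl, .load x y σ⟩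

theorem Runs.store (x y : ℕ) (σ : State) :
    Runs (.store x y) σ 1 { σ with mem := Function.update σ.mem (σ.reg x) (σ.reg y) } :=
  ⟨1, le_rfl, .store x y σ⟩

/-- A loop that counts down the register `x`. -/
theorem Runs.loop {x : ℕ} {P : Program} {B : ℕ} (I : ℕ → State → Prop) (K : ℕ)
    (hx : ∀ i ≤ K, ∀ σ, I i σ → σ.reg x = K - i)
    (hP : ∀ i < K, ∀ σ, I i σ → ∃ σ', Runs P σ B σ' ∧ I (i + 1) σ') {σ : State} (hσ : I 0 σ) :
    ∃ σ', Runs (.whileNonzero x P) σ (K * (B + 1) + 1) σ' ∧ I K σ' := by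
  have key : ∀ j i, i + j = K → ∀ σ, I i σ →
      ∃ σ', Runs (.whileNonzero x P) σ (j * (B + 1) + 1) σ' ∧ I K σ' := by
    intro j
    induction j with
    | zero =>
      intro i hi σ hσ
      obtain rfl : i = K := hi
      exact ⟨σ, ⟨1, by omega, .while_done (by rw [hx i le_rfl σ hσ, Nat.sub_self])⟩, hσ⟩
    | succ j ih =>
      intro i hi σ hσ
      obtain ⟨σ', ⟨k, hk, h1⟩, h2⟩ := hP i (by omega) σ hσ
      obtain ⟨σ'', ⟨l, hl, h3⟩, h4⟩ := ih (i + 1) (by omega) σ' h2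
      refine ⟨σ'', ⟨k + l + 1, ?_, .while_step (by rw [hx i (by omega) σ hσ]; omega) h1 h3⟩, h4⟩
      rw [Nat.add_mul]
      omega
  exact key K 0 (Nat.zero_add K) σ hσ

/-- `σ'` arises from `σ` by changes of registers from `d` on, and it has `a` in register `d`. -/
structure Yields (σ σ' : State) (d a : ℕ) : Prop where
  mem : σ'.mem = σ.mem
  reg : ∀ r < d, σ'.reg r = σ.reg r
  val : σ'.reg d = a

/-! ### Correctness and running time of compiled expressions -/

namespace Expr

/-- Variables live in registers below `d`, which the code never changes. Intermediate results are
protected by evaluating later subexpressions with a larger `d`. -/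
theorem runs_compile (X : ℕ) (e : Expr) : ∀ (ρ : ℕ → ℕ) (d : ℕ), (∀ i, ρ i < d) → ∀ (σ : State)
    (v : ℕ → ℕ), (∀ i, σ.reg (ρ i) = v i) → Fits X σ.mem e v →
    ∃ σ', Runs (compile e ρ d) σ (time X e) σ' ∧ Yields σ σ' d (eval σ.mem e v) := by
  induction e with
  | var i =>
    intro ρ d hρ σ v hv _
    refine ⟨_, (Runs.const _ _ _).seq (Runs.add _ _ _ _), rfl, fun r hr => ?_, ?_⟩
    · simp [hr.ne]
    · simp [(hρ i).ne, hv, eval]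
  | const c =>
    intro ρ d hρ σ v hv _
    refine ⟨_, Runs.const _ _ _, rfl, fun r hr => ?_, ?_⟩
    · simp [hr.ne]
    · simp [eval]
  | add a b iha ihb =>
    intro ρ d hρ σ v hv hf
    obtain ⟨σ₁, h1, m1, r1, v1⟩ := iha ρ d hρ σ v hv hf.1
    obtain ⟨σ₂, h2, m2, r2, v2⟩ := ihb ρ (d + 1) (fun i => (hρ i).trans (Nat.lt_succ_self d)) σ₁ v
      (fun i => (r1 _ (hρ i)).trans (hv i)) (m1 ▸ hf.2)
    refine ⟨_, (h1.seq h2).seq (Runs.add _ _ _ _), m2.trans m1, fun r hr => ?_, ?_⟩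
    · simp [hr.ne, r2 r (by omega), r1 r hr]
    · simp [v2, r2 d (by omega), v1, m1, eval]
  | sub a b iha ihb =>
    intro ρ d hρ σ v hv hf
    obtain ⟨σ₁, h1, m1, r1, v1⟩ := iha ρ d hρ σ v hv hf.1
    obtain ⟨σ₂, h2, m2, r2, v2⟩ := ihb ρ (d + 1) (fun i => (hρ i).trans (Nat.lt_succ_self d)) σ₁ v
      (fun i => (r1 _ (hρ i)).trans (hv i)) (m1 ▸ hf.2)
    refine ⟨_, (h1.seq h2).seq (Runs.sub _ _ _ _), m2.trans m1, fun r hr => ?_, ?_⟩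
    · simp [hr.ne, r2 r (by omega), r1 r hr]
    · simp [v2, r2 d (by omega), v1, m1, eval]
  | load a iha =>
    intro ρ d hρ σ v hv hf
    obtain ⟨σ₁, h1, m1, r1, v1⟩ := iha ρ d hρ σ v hv hf
    refine ⟨_, h1.seq (Runs.load _ _ _), m1, fun r hr => ?_, ?_⟩
    · simp [hr.ne, r1 r hr]
    · simp [v1, m1, eval]
  | ite c a b ihc iha ihb =>
    intro ρ d hρ σ v hv hf
    obtain ⟨σ₁, h1, m1, r1, v1⟩ := ihc ρ d hρ σ v hv hf.1
    by_cases h0 : eval σ.mem c v = 0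
    · obtain ⟨σ₂, ⟨k, hk, h2⟩, m2, r2, v2⟩ := ihb ρ d hρ σ₁ v
        (fun i => (r1 _ (hρ i)).trans (hv i)) (m1 ▸ hf.2.2 h0)
      refine ⟨σ₂, h1.seq ⟨k + 1, by omega, .if_false (v1.trans h0) h2⟩, m2.trans m1,
        fun r hr => (r2 r hr).trans (r1 r hr), ?_⟩
      simp [v2, m1, eval, h0]
    · obtain ⟨σ₂, ⟨k, hk, h2⟩, m2, r2, v2⟩ := iha ρ d hρ σ₁ v
        (fun i => (r1 _ (hρ i)).trans (hv i)) (m1 ▸ hf.2.1 h0)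
      refine ⟨σ₂, h1.seq ⟨k + 1, by omega, .if_true (by rwa [v1]) h2⟩, m2.trans m1,
        fun r hr => (r2 r hr).trans (r1 r hr), ?_⟩
      simp [v2, m1, eval, h0]
  | rename ρ' a iha =>
    intro ρ d hρ σ v hv hf
    exact iha (fun i => ρ (ρ' i)) d (fun i => hρ _) σ (fun i => v (ρ' i)) (fun i => hv _) hf
  | iter k a b ihk iha ihb =>
    intro ρ d hρ σ v hv hf
    obtain ⟨fk, fa, fX, fb⟩ := hf
    obtain ⟨σ₁, h1, m1, r1, v1⟩ := ihk ρ d hρ σ v hv fk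
    obtain ⟨σ₂, h2, m2, r2, v2⟩ := iha ρ (d + 1) (fun i => (hρ i).trans (Nat.lt_succ_self d)) σ₁ v
      (fun i => (r1 _ (hρ i)).trans (hv i)) (m1 ▸ fa)
    generalize hK : eval σ.mem k v = K at *
    -- Register `d` counts the remaining rounds, `d + 1` is the accumulator, `d + 2` the round
    -- number, and `d + 3` holds the constant 1.
    let I : ℕ → State → Prop := fun i τ => τ.mem = σ.mem ∧ (∀ r < d, τ.reg r = σ.reg r) ∧
      τ.reg d = K - i ∧ τ.reg (d + 1) = eval σ.mem (iter (const i) a b) v ∧ τ.reg (d + 2) = i ∧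
      τ.reg (d + 3) = 1
    have hbody : ∀ i < K, ∀ τ, I i τ → ∃ τ', Runs (.seq
        (compile b (push (d + 1) (push (d + 2) ρ)) (d + 4)) <|
          .seq (.seq (.const (d + 1) 0) (.add (d + 1) (d + 1) (d + 4))) <|
          .seq (.add (d + 2) (d + 2) (d + 3)) (.sub d d (d + 3))) τ (time X b + 4) τ' ∧
        I (i + 1) τ' := by
      rintro i hi τ ⟨i1, i2, i3, i4, i5, i6⟩
      obtain ⟨τ₁, g1, n1, s1, w1⟩ := ihb (push (d + 1) (push (d + 2) ρ)) (d + 4) (by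
          rintro (_ | _ | i)
          · simp
          · simp
          · have := hρ i
            simp only [push_succ]
            omega) τ (push (eval σ.mem (iter (const i) a b) v) (push i v)) (by
          rintro (_ | _ | j)
          · simp [i4]
          · simp [i5]
          · simp [i2 _ (hρ j), hv]) (i1 ▸ fb i hi)
      refine ⟨_, g1.seq (((Runs.const _ _ _).seq (Runs.add _ _ _ _)).seq
        ((Runs.add _ _ _ _).seq (Runs.sub _ _ _ _))), n1.trans i1, fun r hr => ?_, ?_, ?_, ?_, ?_⟩
      · simp [hr.ne, (show r ≠ d + 1 by omega), (show r ≠ d + 2 by omega), s1 r (by omega), i2 r hr]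
      · simp [s1 d (by omega), s1 (d + 3) (by omega), i3, i6]
        omega
      · simp [w1, i1, eval]
      · simp [s1 (d + 2) (by omega), s1 (d + 3) (by omega), i5, i6]
      · simp [s1 (d + 3) (by omega), i6]
    obtain ⟨σ₃, h3, i1, i2, i3, i4, i5, i6⟩ := Runs.loop (x := d) I K (fun i _ τ h => h.2.2.1) hbody
      (σ := ⟨Function.update (Function.update σ₂.reg (d + 2) 0) (d + 3) 1, σ₂.mem⟩)
      ⟨m2.trans m1, fun r hr => by
        simp [(show r ≠ d + 2 by omega), (show r ≠ d + 3 by omega), r2 r (by omega), r1 r hr],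
        by simp [r2 d (by omega), v1], by simp [v2, m1, eval], by simp, by simp⟩
    refine ⟨_, h1.seq (h2.seq ((Runs.const _ _ _).seq ((Runs.const _ _ _).seq
      ((h3.mono ?_).seq ((Runs.const _ _ _).seq (Runs.add _ _ _ _)))))), i1, fun r hr => ?_, ?_⟩
    · have := Nat.mul_le_mul_right (time X b + 5) fX
      simpa using this
    · simp [hr.ne, i2 r hr]
    · simp [i4, eval, hK]

/-- For a fixed expression, `time` is a polynomial in `X` whose degree comes from the nesting of
loops. One `c` serves as coefficient and exponent, so bounds for subexpressions combine by adding
constants. -/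
theorem time_le (e : Expr) : ∃ c, ∀ X, 1 ≤ X → time X e ≤ c * X ^ c := by
  have two : ∀ {c d X : ℕ}, 1 ≤ X → c * X ^ c + d * X ^ d + 1 ≤ (c + d + 1) * X ^ (c + d + 1) := by
    intro c d X hX
    have h1 : X ^ c ≤ X ^ (c + d + 1) := Nat.pow_le_pow_right hX (by omega)
    have h2 : X ^ d ≤ X ^ (c + d + 1) := Nat.pow_le_pow_right hX (by omega)
    have h3 : 1 ≤ X ^ (c + d + 1) := Nat.one_le_pow _ _ hX
    nlinarith
  have one : ∀ {c X : ℕ}, 1 ≤ X → c * X ^ c + 1 ≤ (c + 1) * X ^ (c + 1) := by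
    intro c X hX
    have h1 : X ^ c ≤ X ^ (c + 1) := Nat.pow_le_pow_right hX (by omega)
    have h3 : 1 ≤ X ^ (c + 1) := Nat.one_le_pow _ _ hX
    nlinarith
  induction e with
  | var i => exact ⟨2, fun X hX => by have := Nat.one_le_pow 2 X hX; simp only [time]; linarith⟩
  | const c => exact ⟨1, fun X hX => by simpa [time] using hX⟩
  | add a b iha ihb =>
    obtain ⟨ca, ha⟩ := iha
    obtain ⟨cb, hb⟩ := ihb
    refine ⟨ca + cb + 1, fun X hX => le_trans ?_ (two hX)⟩
    simp only [time]
    have := ha X hX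
    have := hb X hX
    omega
  | sub a b iha ihb =>
    obtain ⟨ca, ha⟩ := iha
    obtain ⟨cb, hb⟩ := ihb
    refine ⟨ca + cb + 1, fun X hX => le_trans ?_ (two hX)⟩
    simp only [time]
    have := ha X hX
    have := hb X hX
    omega
  | load a iha =>
    obtain ⟨ca, ha⟩ := iha
    refine ⟨ca + 1, fun X hX => le_trans ?_ (one hX)⟩
    simp only [time]
    have := ha X hX
    omega
  | ite c a b ihc iha ihb =>
    obtain ⟨cc, hc⟩ := ihc
    obtain ⟨ca, ha⟩ := iha
    obtain ⟨cb, hb⟩ := ihb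
    refine ⟨cc + (ca + cb + 1) + 1, fun X hX => le_trans ?_ (two hX)⟩
    simp only [time]
    have := ha X hX
    have := hb X hX
    have := hc X hX
    have := two (c := ca) (d := cb) hX
    omega
  | rename ρ a iha => exact iha
  | iter k a b ihk iha ihb =>
    obtain ⟨ck, hk⟩ := ihk
    obtain ⟨ca, ha⟩ := iha
    obtain ⟨cb, hb⟩ := ihb
    refine ⟨ck + ca + cb + 10, fun X hX => ?_⟩
    simp only [time]
    have h1 := hk X hX
    have h2 := ha X hX
    have h3 := Nat.mul_le_mul_left X (hb X hX)
    have e1 : X ^ ck ≤ X ^ (ck + ca + cb + 10) := Nat.pow_le_pow_right hX (by omega)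
    have e2 : X ^ ca ≤ X ^ (ck + ca + cb + 10) := Nat.pow_le_pow_right hX (by omega)
    have e3 : X ^ (cb + 1) ≤ X ^ (ck + ca + cb + 10) := Nat.pow_le_pow_right hX (by omega)
    have e4 : X ^ 1 ≤ X ^ (ck + ca + cb + 10) := Nat.pow_le_pow_right hX (by omega)
    rw [pow_one] at e4
    have e5 : X * (cb * X ^ cb) = cb * X ^ (cb + 1) := by ring
    rw [e5] at h3
    have g1 := Nat.mul_le_mul_left ck e1
    have g2 := Nat.mul_le_mul_left ca e2
    have g3 := Nat.mul_le_mul_left cb e3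
    rw [Nat.mul_add]
    have e6 : (ck + ca + cb + 10) * X ^ (ck + ca + cb + 10) = ck * X ^ (ck + ca + cb + 10) +
      ca * X ^ (ck + ca + cb + 10) + cb * X ^ (ck + ca + cb + 10) +
      10 * X ^ (ck + ca + cb + 10) := by ring
    rw [e6]
    omega

end Expr

/-- A program that writes the values of `e` to the addresses `a`, for all values of the variable `0`
that are less than `k`, and then outputs the value of `o`. -/
def tableProgram (k a e o : Expr) : Program :=
  .seq (k.compile (fun _ => 0) 1) <| .seq (.const 2 0) <| .seq (.const 3 1) <| .seq
    (.whileNonzero 1 <|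
      .seq (a.compile (push 2 fun _ => 0) 4) <| .seq (e.compile (push 2 fun _ => 0) 5) <|
      .seq (.store 4 5) <| .seq (.add 2 2 3) (.sub 1 1 3)) <|
    .seq (o.compile (fun _ => 0) 4) <| .seq (.const 0 0) (.add 0 0 4)

/-- `M j` is the memory after `j` rounds of writing. The hypotheses refer to the whole sequence
because an entry may read those written before it. -/
theorem outputsWithin_tableProgram {k a e o : Expr} {X K : ℕ} {input : List ℕ} (M : ℕ → ℕ → ℕ)
    (h0 : M 0 = (initial input).mem) (hk : k.eval (M 0) (fun _ => 0) = K)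
    (hkf : k.Fits X (M 0) fun _ => 0) (hK : K ≤ X)
    (hM : ∀ j < K, M (j + 1) = Function.update (M j) (a.eval (M j) (push j fun _ => 0))
      (e.eval (M j) (push j fun _ => 0)))
    (haf : ∀ j < K, a.Fits X (M j) (push j fun _ => 0))
    (hef : ∀ j < K, e.Fits X (M j) (push j fun _ => 0))
    (hof : o.Fits X (M K) fun _ => 0) :
    OutputsWithin (tableProgram k a e o) input (o.eval (M K) fun _ => 0)
      (k.time X + X * (a.time X + e.time X + 3 + 1) + o.time X + 5) := by
  obtain ⟨σ₁, h1, m1, r1, v1⟩ := Expr.runs_compile X k (fun _ => 0) 1 (fun _ => Nat.one_pos)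
    (initial input) (fun _ => 0) (fun _ => rfl) (h0 ▸ hkf)
  rw [← h0, hk] at v1
  let I : ℕ → State → Prop := fun j τ => τ.mem = M j ∧ τ.reg 0 = 0 ∧ τ.reg 1 = K - j ∧
    τ.reg 2 = j ∧ τ.reg 3 = 1
  have hbody : ∀ j < K, ∀ τ, I j τ → ∃ τ', Runs (.seq (a.compile (push 2 fun _ => 0) 4) <|
      .seq (e.compile (push 2 fun _ => 0) 5) <| .seq (.store 4 5) <|
      .seq (.add 2 2 3) (.sub 1 1 3)) τ (a.time X + e.time X + 3) τ' ∧ I (j + 1) τ' := by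
    rintro j hj τ ⟨i1, i2, i3, i4, i5⟩
    have hv : ∀ i, τ.reg (push 2 (fun _ => 0) i) = push j (fun _ => 0) i := by
      rintro (_ | i)
      · exact i4
      · exact i2
    have hρ : ∀ d, ∀ i, push 2 (fun _ => 0) i < d + 4 := by
      rintro d (_ | i) <;> simp
    obtain ⟨τ₁, g1, n1, s1, w1⟩ := Expr.runs_compile X a _ 4 (hρ 0) τ _ hv (i1 ▸ haf j hj)
    obtain ⟨τ₂, g2, n2, s2, w2⟩ := Expr.runs_compile X e _ 5 (hρ 1) τ₁ (push j fun _ => 0)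
      (fun i => (s1 _ (hρ 0 i)).trans (hv i)) (n1 ▸ i1 ▸ hef j hj)
    refine ⟨_, (g1.seq (g2.seq ((Runs.store _ _ _).seq ((Runs.add _ _ _ _).seq
      (Runs.sub _ _ _ _))))).mono (by omega), ?_, ?_, ?_, ?_, ?_⟩
    · simp only [hM j hj, n2, n1, i1, s2 4 (by omega), w1, w2]
    · simp [s2 0 (by omega), s1 0 (by omega), i2]
    · simp [s2 1 (by omega), s1 1 (by omega), s2 3 (by omega), s1 3 (by omega), i3, i5]
      omega
    · simp [s2 2 (by omega), s1 2 (by omega), s2 3 (by omega), s1 3 (by omega), i4, i5]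
    · simp [s2 3 (by omega), s1 3 (by omega), i5]
  obtain ⟨σ₂, h2, i1, i2, i3, i4, i5⟩ := Runs.loop (x := 1) I K (fun i _ τ h => h.2.2.1) hbody
    (σ := ⟨Function.update (Function.update σ₁.reg 2 0) 3 1, σ₁.mem⟩)
    ⟨m1.trans h0.symm, by simp [r1 0 (by omega)]; rfl, by simp [v1], by simp, by simp⟩
  obtain ⟨σ₃, h3, m3, r3, v3⟩ := Expr.runs_compile X o (fun _ => 0) 4 (fun _ => by omega) σ₂
    (fun _ => 0) (fun _ => i2) (i1 ▸ hof)
  obtain ⟨l, hl, h4⟩ := h1.seq ((Runs.const _ _ _).seq ((Runs.const _ _ _).seq (h2.seq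
    (h3.seq ((Runs.const _ _ _).seq (Runs.add _ _ _ _))))))
  refine ⟨l, hl.trans ?_, _, h4, ?_⟩
  · have := Nat.mul_le_mul_right (a.time X + e.time X + 3 + 1) hK
    omega
  · simp [v3, i1]

end RAM

namespace RAM

/-! ### A library of expressions -/

namespace Expr

/-- Weakening by one variable. -/
def up (a : Expr) : Expr := rename Nat.succ a

/-- The sum of `b` over all values of the variable `0` less than `k`. -/
def sum (k b : Expr) : Expr := iter k (const 0) (add (var 0) (up b))

def mul (a b : Expr) : Expr := sum b (up a)

/-- The quotient, by counting multiples. -/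
def div (a b : Expr) : Expr :=
  sum a (sub (const 1) (sub (mul (up b) (add (var 0) (const 1))) (up a)))

def mod (a b : Expr) : Expr := sub a (mul b (div a b))

def pow (a k : Expr) : Expr := iter k (const 1) (mul (var 0) (up (up a)))

def and (a b : Expr) : Expr := ite a b (const 0)

def imp (a b : Expr) : Expr := ite a b (const 1)

def not (a : Expr) : Expr := sub (const 1) a

def lt (a b : Expr) : Expr := sub b a

def eq (a b : Expr) : Expr := not (add (sub a b) (sub b a))

def ex (k b : Expr) : Expr := sum k b

def all (k b : Expr) : Expr := not (sum k (not b))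

def bit (a : Expr) : Expr := ite a (const 1) (const 0)

end Expr

/-- In the environment `v`, the expression `e` has the value `x`, and its evaluation runs no loop
with more than `X` rounds. -/
structure Val (X : ℕ) (m : ℕ → ℕ) (e : Expr) (v : ℕ → ℕ) (x : ℕ) : Prop where
  eval : e.eval m v = x
  fits : e.Fits X m v

/-- In the environment `v`, the expression `e` is nonzero iff `p` holds, and its evaluation runs no
loop with more than `X` rounds. -/
structure Tru (X : ℕ) (m : ℕ → ℕ) (e : Expr) (v : ℕ → ℕ) (p : Prop) : Prop where
  eval : e.eval m v ≠ 0 ↔ p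
  fits : e.Fits X m v

/-! ### Rules for evaluating expressions -/

variable {X : ℕ} {m : ℕ → ℕ} {a b c k : Expr} {v : ℕ → ℕ} {x y z : ℕ} {p q : Prop}

theorem Val.congr (h : Val X m a v x) (e : x = y) : Val X m a v y := e ▸ h

theorem Tru.congr (h : Tru X m a v p) (e : p ↔ q) : Tru X m a v q := ⟨h.eval.trans e, h.fits⟩

theorem Val.tru (h : Val X m a v x) : Tru X m a v (x ≠ 0) := ⟨by rw [h.eval], h.fits⟩

theorem Val.var (i : ℕ) : Val X m (.var i) v (v i) := ⟨rfl, trivial⟩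

theorem Val.const (i : ℕ) : Val X m (.const i) v i := ⟨rfl, trivial⟩

theorem Val.add (ha : Val X m a v x) (hb : Val X m b v y) : Val X m (.add a b) v (x + y) :=
  ⟨by rw [Expr.eval, ha.eval, hb.eval], ha.fits, hb.fits⟩

theorem Val.sub (ha : Val X m a v x) (hb : Val X m b v y) : Val X m (.sub a b) v (x - y) :=
  ⟨by rw [Expr.eval, ha.eval, hb.eval], ha.fits, hb.fits⟩

theorem Val.load (ha : Val X m a v x) : Val X m (.load a) v (m x) :=
  ⟨by rw [Expr.eval, ha.eval], ha.fits⟩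

theorem Val.up (ha : Val X m a v x) : Val X m a.up (push y v) x := ⟨ha.eval, ha.fits⟩

/-- A branch has to be well behaved only if it is taken. `Tru.and` and `Tru.imp` inherit this
laziness, so later conditions may rely on earlier ones. -/
theorem Val.ite [Decidable p] (hc : Tru X m c v p) (ha : p → Val X m a v x) (hb : ¬p → Val X m b v y) :
    Val X m (.ite c a b) v (if p then x else y) := by
  by_cases h : p
  · have h' := hc.eval.2 h
    exact ⟨by simp [Expr.eval, h', h, (ha h).eval], hc.fits, fun _ => (ha h).fits,
      fun h0 => absurd h0 h'⟩
  · have h' : c.eval m v = 0 := not_not.1 fun h' => h (hc.eval.1 h')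
    exact ⟨by simp [Expr.eval, h', h, (hb h).eval], hc.fits, fun h0 => absurd h' h0,
      fun _ => (hb h).fits⟩

theorem Val.iter (f : ℕ → ℕ) (hk : Val X m k v x) (hx : x ≤ X) (ha : Val X m a v (f 0))
    (hb : ∀ i < x, Val X m b (push (f i) (push i v)) (f (i + 1))) :
    Val X m (.iter k a b) v (f x) := by
  have key : ∀ j ≤ x, (Expr.iter (.const j) a b).eval m v = f j := by
    intro j
    induction j with
    | zero => exact fun _ => ha.eval
    | succ j ih =>
      intro hj
      have h := ih (by omega)
      simp only [Expr.eval] at h ⊢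
      rw [h]
      exact (hb j hj).eval
  refine ⟨?_, hk.fits, ha.fits, hk.eval.le.trans hx, fun i hi => ?_⟩
  · have h := key x le_rfl
    simp only [Expr.eval] at h ⊢
    rw [hk.eval, h]
  · rw [hk.eval] at hi
    rw [key i hi.le]
    exact (hb i hi).fits

theorem Val.sum (f : ℕ → ℕ) (hk : Val X m k v x) (hx : x ≤ X)
    (hb : ∀ i < x, Val X m b (push i v) (f i)) :
    Val X m (.sum k b) v (∑ i ∈ Finset.range x, f i) := by
  refine Val.iter (fun j => ∑ i ∈ Finset.range j, f i) hk hx (Val.const 0) fun i hi => ?_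
  simp only [Finset.sum_range_succ]
  exact Val.add (Val.var 0) (hb i hi).up

theorem Val.mul (ha : Val X m a v x) (hb : Val X m b v y) (hy : y ≤ X) :
    Val X m (.mul a b) v (x * y) :=
  (Val.sum (fun _ => x) hb hy fun _ _ => ha.up).congr (by simp [Nat.mul_comm])

/-- A summand is 1 if `y * (i + 1) ≤ x` and 0 otherwise, so the sum counts the positive multiples of
`y` up to `x`. -/
theorem _root_.Nat.sum_range_one_sub_eq_div {y : ℕ} (x : ℕ) (hy : 0 < y) :
    ∑ i ∈ Finset.range x, (1 - (y * (i + 1) - x)) = x / y := by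
  have h : ∀ i ∈ Finset.range x, 1 - (y * (i + 1) - x) = if i < x / y then 1 else 0 := by
    intro i _
    have : i < x / y ↔ y * (i + 1) ≤ x := by
      rw [Nat.lt_iff_add_one_le, Nat.le_div_iff_mul_le hy, Nat.mul_comm]
    split_ifs with h <;> rw [this] at h <;> omega
  rw [Finset.sum_congr rfl h, Finset.sum_ite, Finset.sum_const_zero, Nat.add_zero,
    Finset.sum_const, smul_eq_mul, Nat.mul_one]
  have : (Finset.range x).filter (· < x / y) = Finset.range (x / y) := by
    ext i
    have := Nat.div_le_self x y
    simp only [Finset.mem_filter, Finset.mem_range]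
    omega
  rw [this, Finset.card_range]

theorem Val.div (ha : Val X m a v x) (hb : Val X m b v y) (hx : x ≤ X) (hy : 0 < y) :
    Val X m (.div a b) v (x / y) :=
  (Val.sum (fun i => 1 - (y * (i + 1) - x)) ha hx fun i hi => (Val.const 1).sub
    ((hb.up.mul ((Val.var 0).add (Val.const 1)) (by simp; omega)).sub ha.up)).congr
    (Nat.sum_range_one_sub_eq_div x hy)

theorem Val.mod (ha : Val X m a v x) (hb : Val X m b v y) (hx : x ≤ X) (hy : 0 < y) :
    Val X m (.mod a b) v (x % y) :=
  (ha.sub (hb.mul (ha.div hb hx hy) ((Nat.div_le_self x y).trans hx))).congr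
    (Nat.mod_eq_sub x y).symm

theorem Val.pow (ha : Val X m a v x) (hk : Val X m k v y) (hx : x ≤ X) (hy : y ≤ X) :
    Val X m (.pow a k) v (x ^ y) := by
  refine Val.iter (fun j => x ^ j) hk hy (Val.const 1) fun i _ => ?_
  exact ((Val.var 0).mul ha.up.up hx)

theorem Tru.and (ha : Tru X m a v p) (hb : p → Tru X m b v q) : Tru X m (.and a b) v (p ∧ q) := by
  classical
  refine (Val.ite ha (fun h => ⟨rfl, (hb h).fits⟩) fun _ => Val.const 0).tru.congr ?_
  by_cases h : p
  · simp [h, (hb h).eval]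
  · simp [h]

theorem Tru.imp (ha : Tru X m a v p) (hb : p → Tru X m b v q) : Tru X m (.imp a b) v (p → q) := by
  classical
  refine (Val.ite ha (fun h => ⟨rfl, (hb h).fits⟩) fun _ => Val.const 1).tru.congr ?_
  by_cases h : p
  · simp [h, (hb h).eval]
  · simp [h]

theorem Tru.not (ha : Tru X m a v p) : Tru X m (.not a) v (¬p) :=
  ⟨by rw [← ha.eval]; simp only [Expr.not, Expr.eval]; omega, trivial, ha.fits⟩

theorem Tru.lt (ha : Val X m a v x) (hb : Val X m b v y) : Tru X m (.lt a b) v (x < y) :=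
  (hb.sub ha).tru.congr Nat.sub_ne_zero_iff_lt

theorem Tru.eq (ha : Val X m a v x) (hb : Val X m b v y) : Tru X m (.eq a b) v (x = y) :=
  ((ha.sub hb).add (hb.sub ha)).tru.not.congr (by omega)

theorem Tru.ex {P : Fin x → Prop} (hk : Val X m k v x) (hx : x ≤ X)
    (hb : ∀ i : Fin x, Tru X m b (push i v) (P i)) : Tru X m (.ex k b) v (∃ i, P i) := by
  refine (Val.sum (fun i => b.eval m (push i v)) hk hx
    fun i hi => ⟨rfl, (hb ⟨i, hi⟩).fits⟩).tru.congr ?_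
  rw [Ne, Finset.sum_eq_zero_iff]
  push Not
  constructor
  · rintro ⟨i, hi, h⟩
    exact ⟨⟨i, Finset.mem_range.1 hi⟩, (hb _).eval.1 h⟩
  · rintro ⟨i, h⟩
    exact ⟨i, Finset.mem_range.2 i.isLt, (hb i).eval.2 h⟩

theorem Tru.all {P : Fin x → Prop} (hk : Val X m k v x) (hx : x ≤ X)
    (hb : ∀ i : Fin x, Tru X m b (push i v) (P i)) : Tru X m (.all k b) v (∀ i, P i) :=
  (Tru.ex hk hx fun i => (hb i).not).not.congr (by simp)

theorem Tru.bit [Decidable p] (ha : Tru X m a v p) : Val X m a.bit v (if p then 1 else 0) :=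
  Val.ite ha (fun _ => Val.const 1) fun _ => Val.const 0

end RAM

namespace RAM

open TreeDecomposition

/-! ### Access to the input -/

open Classical in
/-- The memory `m` contains the input word. -/
structure Represents (m : ℕ → ℕ) {n : ℕ} (G : SimpleGraph (Fin n)) (s : Fin n) (t : ℕ)
    (D : TreeDecomposition G) : Prop where
  n_eq : m 0 = n
  s_eq : m 1 = s
  t_eq : m 2 = t
  size_eq : m 3 = D.size
  root_eq : m 4 = D.root
  adj_eq : ∀ u v : Fin n, m (5 + u * n + v) = if G.Adj u v then 1 else 0
  parent_eq : ∀ x : Fin D.size, m (5 + n * n + x) = D.parent x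
  bag_eq : ∀ (x : Fin D.size) (v : Fin n),
    m (5 + n * n + D.size + x * n + v) = if v ∈ D.bag x then 1 else 0

/-- The length of the input word. -/
def inputLength (n N : ℕ) : ℕ := 5 + n * n + N + N * n

theorem _root_.Nat.mul_add_lt_mul_of_lt {a b n k : ℕ} (ha : a < k) (hb : b < n) :
    a * n + b < k * n := calc
  a * n + b < (a + 1) * n := by rw [Nat.add_mul, Nat.one_mul]; omega
  _ ≤ k * n := Nat.mul_le_mul_right _ ha

section Input

variable {n : ℕ} {G : SimpleGraph (Fin n)} {s : Fin n} {t : ℕ} {D : TreeDecomposition G}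
variable {X : ℕ} {m : ℕ → ℕ}

/-- The table is stored behind the input word, so writing to it leaves the input readable. -/
theorem Represents.congr {m' : ℕ → ℕ} (h : Represents m G s t D)
    (hm : ∀ i < inputLength n D.size, m' i = m i) : Represents m' G s t D where
  n_eq := by rw [hm _ (by rw [inputLength]; omega), h.n_eq]
  s_eq := by rw [hm _ (by rw [inputLength]; omega), h.s_eq]
  t_eq := by rw [hm _ (by rw [inputLength]; omega), h.t_eq]
  size_eq := by rw [hm _ (by rw [inputLength]; omega), h.size_eq]
  root_eq := by rw [hm _ (by rw [inputLength]; omega), h.root_eq]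
  adj_eq u v := by
    have := Nat.mul_add_lt_mul_of_lt u.isLt v.isLt
    rw [hm _ (by rw [inputLength]; omega), h.adj_eq]
  parent_eq x := by
    have := x.isLt
    rw [hm _ (by rw [inputLength]; omega), h.parent_eq]
  bag_eq x v := by
    have := Nat.mul_add_lt_mul_of_lt x.isLt v.isLt
    rw [hm _ (by rw [inputLength]; omega), h.bag_eq]

theorem _root_.List.getD_flatMap_finRange {k n : ℕ} (f : Fin k → Fin n → ℕ) (l : List ℕ) (i : Fin k)
    (j : Fin n) : (((List.finRange k).flatMap fun i => (List.finRange n).map (f i)) ++ l).getD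
      (i * n + j) 0 = f i j := by
  induction k with
  | zero => exact i.elim0
  | succ k ih =>
    rw [List.finRange_succ, List.flatMap_cons, List.append_assoc]
    refine Fin.cases ?_ (fun i => ?_) i
    · rw [List.getD_append _ _ _ _ (by simp)]
      simp
    · rw [List.getD_append_right _ _ _ _ (by
        simp only [List.length_map, List.length_finRange, Fin.val_succ]
        rw [Nat.add_mul]
        omega)]
      simp only [List.length_map, List.length_finRange, Fin.val_succ, List.flatMap_map]
      rw [show (i.val + 1) * n + j - n = i * n + j by rw [Nat.add_mul]; omega]
      exact ih (fun i => f i.succ) i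

theorem represents_initial (G : SimpleGraph (Fin n)) (s : Fin n) (t : ℕ)
    (D : TreeDecomposition G) : Represents (initial (encodeInput G s t D)).mem G s t D where
  n_eq := rfl
  s_eq := rfl
  t_eq := rfl
  size_eq := rfl
  root_eq := rfl
  adj_eq u v := by
    classical
    simp only [initial, encodeInput, List.append_assoc]
    rw [List.getD_append_right _ _ _ _ (by simp; omega)]
    rw [show 5 + u.val * n + v - [n, s, t, D.size, D.root].length = u * n + v by simp; omega]
    exact List.getD_flatMap_finRange (fun u v => if G.Adj u v then 1 else 0) _ u v
  parent_eq x := by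
    classical
    simp only [initial, encodeInput, List.append_assoc]
    rw [List.getD_append_right _ _ _ _ (by simp; omega),
      List.getD_append_right _ _ _ _ (by simp; omega)]
    rw [List.getD_append _ _ _ _ (by simp; omega)]
    simp
    rw [show 5 + n * n + x.val - 5 - n * n = x by omega]
    simp
  bag_eq x v := by
    classical
    simp only [initial, encodeInput, List.append_assoc]
    rw [List.getD_append_right _ _ _ _ (by simp; omega),
      List.getD_append_right _ _ _ _ (by simp; omega),
      List.getD_append_right _ _ _ _ (by simp; omega)]
    have := List.getD_flatMap_finRange (fun x v => if v ∈ D.bag x then 1 else 0) [] x v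
    rw [List.append_nil] at this
    rw [← this]
    congr 1
    simp
    omega

end Input

/-! ### Expressions for the input data and for coded states -/

namespace Expr

def nE : Expr := load (const 0)
def sE : Expr := load (const 1)
def tE : Expr := load (const 2)
def sizeE : Expr := load (const 3)
def rootE : Expr := load (const 4)

def adjE (u v : Expr) : Expr := load (add (add (const 5) (mul u nE)) v)

def parentE (x : Expr) : Expr := load (add (add (const 5) (mul nE nE)) x)

def bagE (x v : Expr) : Expr :=
  load (add (add (add (add (const 5) (mul nE nE)) sizeE) (mul x nE)) v)

def inputLengthE : Expr := add (add (add (const 5) (mul nE nE)) sizeE) (mul sizeE nE)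

def rankE (x v : Expr) : Expr := sum v (bagE (up x) (var 0))

def bagCardE (x : Expr) : Expr := sum nE (bagE (up x) (var 0))

/-- The maximal size of a bag. -/
def maxCardE : Expr := iter sizeE (const 0) (add (var 0) (sub (bagCardE (var 1)) (var 0)))

def siblingIndexE (y : Expr) : Expr :=
  add (const 1) (sum y (bit (and (not (eq (var 0) rootE)) (eq (parentE (var 0)) (parentE (up y))))))

def numRecordsE : Expr := mul (mul (add tE (const 1)) nE) (pow (const 3) (add tE (const 1)))

def recordE (x σ v : Expr) : Expr := mod (div σ (pow numRecordsE (rankE x v))) numRecordsE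

/-- The time of a vertex in a state. -/
def timeE (x σ v : Expr) : Expr := mod (recordE x σ v) (add tE (const 1))

/-- The caller of a vertex in a state. -/
def callerE (x σ v : Expr) : Expr := mod (div (recordE x σ v) (add tE (const 1))) nE

/-- The child subtree that contains the vertex called at a given time. -/
def calleeE (x σ v i : Expr) : Expr :=
  mod (div (div (recordE x σ v) (mul (add tE (const 1)) nE)) (pow (const 3) i)) (const 3)

end Expr

section Values

open RAM.Expr

variable {n : ℕ} {G : SimpleGraph (Fin n)} {s : Fin n} {t : ℕ} {D : TreeDecomposition G}
variable {X : ℕ} {m v : ℕ → ℕ} {xe ye ue we : Expr} {x y : Fin D.size} {u w : Fin n}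

theorem Represents.val_n (h : Represents m G s t D) : Val X m nE v n :=
  (Val.load (Val.const 0)).congr h.n_eq

theorem Represents.val_s (h : Represents m G s t D) : Val X m sE v s :=
  (Val.load (Val.const 1)).congr h.s_eq

theorem Represents.val_t (h : Represents m G s t D) : Val X m tE v t :=
  (Val.load (Val.const 2)).congr h.t_eq

theorem Represents.val_size (h : Represents m G s t D) : Val X m sizeE v D.size :=
  (Val.load (Val.const 3)).congr h.size_eq

theorem Represents.val_root (h : Represents m G s t D) : Val X m rootE v D.root :=
  (Val.load (Val.const 4)).congr h.root_eq

theorem Represents.tru_adj (h : Represents m G s t D) (hn : n ≤ X) (hu : Val X m ue v u)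
    (hw : Val X m we v w) : Tru X m (adjE ue we) v (G.Adj u w) :=
  ((((Val.const 5).add (hu.mul h.val_n hn)).add hw).load.congr (h.adj_eq u w)).tru.congr (by simp)

theorem Represents.val_parent (h : Represents m G s t D) (hn : n ≤ X) (hx : Val X m xe v x) :
    Val X m (parentE xe) v (D.parent x) :=
  (((Val.const 5).add (h.val_n.mul h.val_n hn)).add hx).load.congr (h.parent_eq x)

open Classical in
theorem Represents.val_bag (h : Represents m G s t D) (hn : n ≤ X) (hx : Val X m xe v x)
    (hu : Val X m ue v u) : Val X m (bagE xe ue) v (if u ∈ D.bag x then 1 else 0) :=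
  (((((Val.const 5).add (h.val_n.mul h.val_n hn)).add h.val_size).add (hx.mul h.val_n hn)).add
    hu).load.congr (h.bag_eq x u)

theorem Represents.tru_bag (h : Represents m G s t D) (hn : n ≤ X) (hx : Val X m xe v x)
    (hu : Val X m ue v u) : Tru X m (bagE xe ue) v (u ∈ D.bag x) :=
  (h.val_bag hn hx hu).tru.congr (by simp)

theorem Represents.val_inputLength (h : Represents m G s t D) (hn : n ≤ X) :
    Val X m inputLengthE v (inputLength n D.size) :=
  (((Val.const 5).add (h.val_n.mul h.val_n hn)).add h.val_size).add (h.val_size.mul h.val_n hn)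

theorem _root_.Fin.sum_range_ite_mem {n k : ℕ} (hk : k ≤ n) (b : Finset (Fin n)) (f : ℕ → ℕ)
    (hf : ∀ i : Fin n, (i : ℕ) < k → f i = if i ∈ b then 1 else 0) :
    ∑ i ∈ Finset.range k, f i = (b.filter fun i : Fin n => (i : ℕ) < k).card := by
  have h1 : ∑ i ∈ Finset.range k, f i = ∑ i ∈ Finset.range n, if i < k then f i else 0 := by
    rw [← Finset.sum_filter]
    congr 1
    ext i
    simp only [Finset.mem_filter, Finset.mem_range]
    omega
  rw [h1, ← Fin.sum_univ_eq_sum_range (fun i => if i < k then f i else 0), Finset.card_filter]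
  have h2 : ∀ i : Fin n, (if (i : ℕ) < k then f i else 0) =
      if i ∈ b then if (i : ℕ) < k then 1 else 0 else 0 := by
    intro i
    by_cases hi : (i : ℕ) < k
    · simp [hi, hf i hi]
    · simp [hi]
  rw [Finset.sum_congr rfl fun i _ => h2 i, Finset.sum_ite_mem, Finset.univ_inter]

theorem Represents.val_rank (h : Represents m G s t D) (hn : n ≤ X) (hx : Val X m xe v x)
    (hu : Val X m ue v u) : Val X m (rankE xe ue) v (D.rank x u) := by
  classical
  refine (Val.sum (fun i => if hi : i < n then if (⟨i, hi⟩ : Fin n) ∈ D.bag x then 1 else 0 else 0)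
    hu (u.isLt.le.trans hn) fun i hi => ?_).congr ?_
  · have hi' : i < n := hi.trans u.isLt
    rw [dif_pos hi']
    exact h.val_bag hn hx.up (Val.var 0)
  · rw [Fin.sum_range_ite_mem u.isLt.le (D.bag x) _ fun i _ => by simp]
    rfl

theorem Represents.val_bagCard (h : Represents m G s t D) (hn : n ≤ X) (hx : Val X m xe v x) :
    Val X m (bagCardE xe) v (D.bag x).card := by
  classical
  refine (Val.sum (fun i => if hi : i < n then if (⟨i, hi⟩ : Fin n) ∈ D.bag x then 1 else 0 else 0)
    h.val_n hn fun i hi => ?_).congr ?_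
  · rw [dif_pos hi]
    exact h.val_bag hn hx.up (Val.var 0)
  · rw [Fin.sum_range_ite_mem le_rfl (D.bag x) _ fun i _ => by simp]
    simp

theorem Represents.val_maxCard (h : Represents m G s t D) (hn : n ≤ X) (hN : D.size ≤ X) :
    Val X m maxCardE v (Finset.univ.sup fun x => (D.bag x).card) := by
  refine (Val.iter (fun k => (Finset.univ.filter fun x : Fin D.size => (x : ℕ) < k).sup
    fun x => (D.bag x).card) h.val_size hN ((Val.const 0).congr (by simp)) fun i hi => ?_).congr ?_
  -- With truncated subtraction, `r + (c - r)` is the maximum of `r` and `c`.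
  · refine ((Val.var 0).add ((h.val_bagCard (x := ⟨i, hi⟩) hn (Val.var 1)).sub (Val.var 0))).congr ?_
    have : (Finset.univ.filter fun x : Fin D.size => (x : ℕ) < i + 1) =
        insert ⟨i, hi⟩ (Finset.univ.filter fun x : Fin D.size => (x : ℕ) < i) := by
      ext x
      simp [Fin.ext_iff]
      omega
    rw [this, Finset.sup_insert]
    simp only [push_zero]
    rcases le_total (D.bag ⟨i, hi⟩).card ((Finset.univ.filter fun x : Fin D.size => (x : ℕ) < i).sup
      fun x => (D.bag x).card) with h | h
    · rw [sup_eq_right.2 h]; omega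
    · rw [sup_eq_left.2 h]; omega
  · congr 1
    simp

theorem Represents.val_siblingIndex (h : Represents m G s t D) (hn : n ≤ X) (hN : D.size ≤ X)
    (hy : Val X m ye v y) : Val X m (siblingIndexE ye) v (D.siblingIndex y) := by
  classical
  refine (Val.add (Val.const 1) (Val.sum (fun i => if hi : i < D.size then
    if (⟨i, hi⟩ : Fin D.size) ∈ Finset.univ.filter fun z => z ≠ D.root ∧ D.parent z = D.parent y
    then 1 else 0 else 0) hy (y.isLt.le.trans hN) fun i hi => ?_)).congr ?_
  · have hi' : i < D.size := hi.trans y.isLt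
    rw [dif_pos hi']
    refine (((Tru.eq (Val.var 0) h.val_root).not.and fun _ =>
      (Tru.eq (h.val_parent (x := ⟨i, hi'⟩) hn (Val.var 0)) (h.val_parent hn hy.up))).bit).congr ?_
    simp only [Finset.mem_filter, Finset.mem_univ, true_and, Fin.ext_iff, push_zero, ne_eq]
    congr
  · rw [Fin.sum_range_ite_mem y.isLt.le (Finset.univ.filter fun z =>
      z ≠ D.root ∧ D.parent z = D.parent y) _ fun i _ => by simp]
    rw [siblingIndex]
    congr 2
    ext z
    simp [and_comm]

end Values

end RAM

namespace RAM

open TreeDecomposition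

/-! ### The constraints as expressions -/

namespace Expr

/-- The condition `IsLocal`. -/
def localE (x σ : Expr) : Expr :=
  all nE <| imp (bagE (up x) (var 0)) <|
    and (imp (not (eq (var 0) sE)) (adjE (var 0) (callerE (up x) (up σ) (var 0)))) <|
    all nE <| imp (bagE (up (up x)) (var 0)) <|
      and
        (imp (not (eq (var 1) sE)) <| imp (eq (var 0) (callerE (up (up x)) (up (up σ)) (var 1))) <|
          and (lt (timeE (up (up x)) (up (up σ)) (var 0)) (timeE (up (up x)) (up (up σ)) (var 1)))
            (not (calleeE (up (up x)) (up (up σ)) (var 0)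
              (timeE (up (up x)) (up (up σ)) (var 1)))))
        (imp (not (eq (var 1) (var 0))) <| imp (not (eq (var 1) sE)) <| imp (not (eq (var 0) sE)) <|
          imp (eq (callerE (up (up x)) (up (up σ)) (var 1))
            (callerE (up (up x)) (up (up σ)) (var 0))) <|
          not (eq (timeE (up (up x)) (up (up σ)) (var 1)) (timeE (up (up x)) (up (up σ)) (var 0))))

/-- The condition `IsCompatible`, for the state `σ'` of `y` and the state `σ` of its parent `x`. -/
def compatibleE (y x σ' σ : Expr) : Expr :=
  all nE <| imp (bagE (up y) (var 0)) <|
    and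
      (imp (bagE (up x) (var 0)) <|
        and (eq (timeE (up y) (up σ') (var 0)) (timeE (up x) (up σ) (var 0))) <|
        and (eq (callerE (up y) (up σ') (var 0)) (callerE (up x) (up σ) (var 0))) <|
        all (add tE (const 1)) <| imp (calleeE (up (up y)) (up (up σ')) (var 1) (var 0)) <|
          eq (calleeE (up (up x)) (up (up σ)) (var 1) (var 0)) (siblingIndexE (up (up y))))
      (imp (not (bagE (up x) (var 0))) <| imp (not (eq (var 0) sE)) <|
        imp (bagE (up x) (callerE (up y) (up σ') (var 0))) <|
        eq (calleeE (up x) (up σ) (callerE (up y) (up σ') (var 0)) (timeE (up y) (up σ') (var 0)))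
          (siblingIndexE (up y)))

end Expr

/-- `X` is so large that loops of length `X` can handle `n` vertices, `N` nodes, `t` rounds, and the
records of single vertices. -/
structure Large (n N t X : ℕ) : Prop where
  n_le : n ≤ X
  size_le : N ≤ X
  t_lt : t < X
  numRecords_le : numRecords n t ≤ X

open RAM.Expr

variable {n : ℕ} {G : SimpleGraph (Fin n)} {s : Fin n} {t : ℕ} {D : TreeDecomposition G}
variable {X : ℕ} {m v : ℕ → ℕ} {xe ye ue we σe σe' ie : Expr} {x y : Fin D.size} {u w : Fin n}
variable {σ σ' i : ℕ}

theorem numRecords_pos (hn : 0 < n) (t : ℕ) : 0 < numRecords n t :=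
  Nat.mul_pos (Nat.mul_pos (Nat.succ_pos t) hn) (by positivity)

theorem Large.three_pow_le {N : ℕ} (hX : Large n N t X) (hn : 0 < n) : 3 ^ (t + 1) ≤ X := by
  refine le_trans ?_ hX.numRecords_le
  exact Nat.le_mul_of_pos_left _ (Nat.mul_pos (Nat.succ_pos t) hn)

theorem Large.three_le {N : ℕ} (hX : Large n N t X) (hn : 0 < n) : 3 ≤ X :=
  le_trans (by simpa using Nat.pow_le_pow_right (n := 3) (by norm_num) (Nat.le_add_left 1 t))
    (hX.three_pow_le hn)

theorem Represents.val_t_add_one (h : Represents m G s t D) :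
    Val X m (.add tE (.const 1)) v (t + 1) := h.val_t.add (Val.const 1)

theorem Represents.val_numRecords (h : Represents m G s t D) (hX : Large n D.size t X) :
    Val X m numRecordsE v (numRecords n t) :=
  (h.val_t_add_one.mul h.val_n hX.n_le).mul ((Val.const 3).pow h.val_t_add_one
    (hX.three_le s.pos) hX.t_lt) (hX.three_pow_le s.pos)

theorem Represents.val_record (h : Represents m G s t D) (hX : Large n D.size t X) (hσ : σ ≤ X)
    (hx : Val X m xe v x) (hσe : Val X m σe v σ) (hu : Val X m ue v u) :
    Val X m (recordE xe σe ue) v (D.record t x σ u) := by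
  have hr : D.rank x u ≤ X := le_trans (Finset.card_le_univ _)
    (by rw [Fintype.card_fin]; exact hX.n_le)
  have hp := numRecords_pos s.pos t
  exact (hσe.div ((h.val_numRecords hX).pow (h.val_rank hX.n_le hx hu) hX.numRecords_le hr) hσ
    (Nat.pow_pos hp)).mod (h.val_numRecords hX) ((Nat.div_le_self _ _).trans hσ) hp

theorem record_le (hσ : σ ≤ X) : D.record t x σ u ≤ X :=
  (Nat.mod_le _ _).trans ((Nat.div_le_self _ _).trans hσ)

theorem Represents.val_time (h : Represents m G s t D) (hX : Large n D.size t X) (hσ : σ ≤ X)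
    (hx : Val X m xe v x) (hσe : Val X m σe v σ) (hu : Val X m ue v u) :
    Val X m (timeE xe σe ue) v ((D.decode t x σ).a u) :=
  (h.val_record hX hσ hx hσe hu).mod h.val_t_add_one (record_le hσ) (Nat.succ_pos t)

theorem Represents.val_caller (h : Represents m G s t D) (hX : Large n D.size t X) (hσ : σ ≤ X)
    (hx : Val X m xe v x) (hσe : Val X m σe v σ) (hu : Val X m ue v u) :
    Val X m (callerE xe σe ue) v ((D.decode t x σ).p u) :=
  ((h.val_record hX hσ hx hσe hu).div h.val_t_add_one (record_le hσ) (Nat.succ_pos t)).mod h.val_n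
    ((Nat.div_le_self _ _).trans (record_le hσ)) s.pos

theorem Represents.val_callee (h : Represents m G s t D) (hX : Large n D.size t X) (hσ : σ ≤ X)
    (hx : Val X m xe v x) (hσe : Val X m σe v σ) (hu : Val X m ue v u) (hi : Val X m ie v i)
    (hit : i ≤ t) : Val X m (calleeE xe σe ue ie) v ((D.decode t x σ).q u i) :=
  (((h.val_record hX hσ hx hσe hu).div (h.val_t_add_one.mul h.val_n hX.n_le) (record_le hσ)
    (Nat.mul_pos (Nat.succ_pos t) s.pos)).div ((Val.const 3).pow hi (hX.three_le s.pos)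
      (hit.trans hX.t_lt.le)) ((Nat.div_le_self _ _).trans (record_le hσ)) (by positivity)).mod
    (Val.const 3) ((Nat.div_le_self _ _).trans ((Nat.div_le_self _ _).trans (record_le hσ)))
    (by norm_num)

/-- The field `le` needs no test, since a decoded time is a residue modulo `t + 1`. -/
theorem Represents.tru_isLocal (h : Represents m G s t D) (hX : Large n D.size t X) (hσ : σ ≤ X)
    (hx : Val X m xe v x) (hσe : Val X m σe v σ) :
    Tru X m (localE xe σe) v (D.IsLocal s t x (D.decode t x σ)) := by
  have hn := hX.n_le
  refine (Tru.all h.val_n hn fun u => Tru.imp (h.tru_bag (u := u) hn hx.up (Val.var 0))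
    fun _ => Tru.and (Tru.imp (Tru.eq (Val.var 0) h.val_s).not fun _ => h.tru_adj (u := u) hn
      (Val.var 0) (h.val_caller (u := u) hX hσ hx.up hσe.up (Val.var 0))) fun _ =>
    Tru.all h.val_n hn fun w => Tru.imp (h.tru_bag (u := w) hn hx.up.up (Val.var 0)) fun _ =>
      Tru.and (Tru.imp (Tru.eq (Val.var 1) h.val_s).not fun _ => Tru.imp
        (Tru.eq (Val.var 0) (h.val_caller (u := u) hX hσ hx.up.up hσe.up.up (Val.var 1))) fun _ =>
        Tru.and (Tru.lt (h.val_time (u := w) hX hσ hx.up.up hσe.up.up (Val.var 0))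
          (h.val_time (u := u) hX hσ hx.up.up hσe.up.up (Val.var 1)))
        fun _ => (h.val_callee (u := w) hX hσ hx.up.up hσe.up.up (Val.var 0)
          (h.val_time (u := u) hX hσ hx.up.up hσe.up.up (Val.var 1)) (decode_a_le _ _ _ _)).tru.not)
      fun _ => Tru.imp (Tru.eq (Val.var 1) (Val.var 0)).not fun _ =>
        Tru.imp (Tru.eq (Val.var 1) h.val_s).not fun _ =>
        Tru.imp (Tru.eq (Val.var 0) h.val_s).not fun _ =>
        Tru.imp (Tru.eq (h.val_caller (u := u) hX hσ hx.up.up hσe.up.up (Val.var 1))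
          (h.val_caller (u := w) hX hσ hx.up.up hσe.up.up (Val.var 0))) fun _ =>
        (Tru.eq (h.val_time (u := u) hX hσ hx.up.up hσe.up.up (Val.var 1))
          (h.val_time (u := w) hX hσ hx.up.up hσe.up.up (Val.var 0))).not).congr ?_
  simp only [push_zero, push_one, Fin.val_inj, not_not]
  constructor
  · intro h
    refine ⟨fun u hu => (h u hu).1, fun u _ => decode_a_le _ _ _ _, ?_, ?_⟩
    · exact fun u hu hus hp => ((h u hu).2 _ hp).1 hus rfl
    · exact fun u hu w hw => ((h u hu).2 w hw).2
  · intro h u hu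
    refine ⟨h.adj u hu, fun w hw => ⟨?_, h.inj u hu w hw⟩⟩
    rintro hus rfl
    exact h.lt u hu hus hw

theorem Represents.tru_isCompatible (h : Represents m G s t D) (hX : Large n D.size t X)
    (hσ : σ ≤ X) (hσ' : σ' ≤ X) (hy : Val X m ye v y) (hx : Val X m xe v (D.parent y))
    (hσe : Val X m σe v σ) (hσe' : Val X m σe' v σ') :
    Tru X m (compatibleE ye xe σe' σe) v
      (D.IsCompatible s t y (D.decode t y σ') (D.decode t (D.parent y) σ)) := by
  have hn := hX.n_le
  have hN := hX.size_le
  refine (Tru.all h.val_n hn fun u => Tru.imp (h.tru_bag (u := u) hn hy.up (Val.var 0)) fun _ =>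
    Tru.and
      (Tru.imp (h.tru_bag (u := u) hn hx.up (Val.var 0)) fun _ =>
        Tru.and (Tru.eq (h.val_time (u := u) hX hσ' hy.up hσe'.up (Val.var 0))
          (h.val_time (u := u) hX hσ hx.up hσe.up (Val.var 0))) fun _ =>
        Tru.and (Tru.eq (h.val_caller (u := u) hX hσ' hy.up hσe'.up (Val.var 0))
          (h.val_caller (u := u) hX hσ hx.up hσe.up (Val.var 0))) fun _ =>
        Tru.all h.val_t_add_one hX.t_lt fun i =>
          Tru.imp (h.val_callee (u := u) (i := i) hX hσ' hy.up.up hσe'.up.up (Val.var 1)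
            (Val.var 0) (Nat.le_of_lt_succ i.isLt)).tru fun _ =>
          Tru.eq (h.val_callee (u := u) (i := i) hX hσ hx.up.up hσe.up.up (Val.var 1)
            (Val.var 0) (Nat.le_of_lt_succ i.isLt)) (h.val_siblingIndex hn hN hy.up.up))
      fun _ => Tru.imp (h.tru_bag (u := u) hn hx.up (Val.var 0)).not fun _ =>
        Tru.imp (Tru.eq (Val.var 0) h.val_s).not fun _ =>
        Tru.imp (h.tru_bag hn hx.up (h.val_caller (u := u) hX hσ' hy.up hσe'.up (Val.var 0)))
          fun _ => Tru.eq (h.val_callee hX hσ hx.up hσe.up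
            (h.val_caller (u := u) hX hσ' hy.up hσe'.up (Val.var 0))
            (h.val_time (u := u) hX hσ' hy.up hσe'.up (Val.var 0)) (decode_a_le _ _ _ _))
            (h.val_siblingIndex hn hN hy.up)).congr ?_
  simp only [push_zero, Fin.val_inj]
  constructor
  · intro h
    refine ⟨fun u hu hu' => ((h u hu).1 hu').1, fun u hu hu' => ((h u hu).1 hu').2.1,
      fun u hu hu' i hi => ?_, fun u hu => (h u hu).2⟩
    exact ((h u hu).1 hu').2.2 ⟨i, Nat.lt_succ_of_le hi⟩
  · exact fun h u hu => ⟨fun hu' => ⟨h.a_eq u hu hu', h.p_eq u hu hu',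
      fun i => h.q_eq u hu hu' i (Nat.le_of_lt_succ i.isLt)⟩, h.q_new u hu⟩

end RAM

namespace RAM

open TreeDecomposition

/-! ### The dynamic program -/

namespace Expr

/-- The number of states of a node. -/
def statesE : Expr := pow numRecordsE maxCardE

def levelE (j : Expr) : Expr := div (div j statesE) sizeE

def nodeE (j : Expr) : Expr := mod (div j statesE) sizeE

def stateE (j : Expr) : Expr := mod j statesE

/-- The table entry for the level `r`, the node `x`, and the state `σ`. -/
def readE (r x σ : Expr) : Expr :=
  load (add inputLengthE (add (mul (add (mul r sizeE) x) statesE) σ))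

/-- The table entry with the number `j`. -/
def entryE (j : Expr) : Expr :=
  ite (levelE j)
    (bit <| and (localE (nodeE j) (stateE j)) <|
      all sizeE <| imp (and (not (eq (var 0) rootE)) (eq (parentE (var 0)) (nodeE (up j)))) <|
        ex statesE <| and
          (compatibleE (var 1) (parentE (var 1)) (var 0) (stateE (up (up j))))
          (readE (sub (levelE (up (up j))) (const 1)) (var 1) (var 0)))
    (const 1)

/-- In all other cases, the answer depends on the number of vertices only. -/
def guardE : Expr :=
  and (lt (const 1) maxCardE) (not (lt (pow (const 2) tE) nE))

def tableSizeE : Expr := ite guardE (mul (mul (add sizeE (const 1)) sizeE) statesE) (const 0)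

def answerE : Expr :=
  bit <| ite guardE (ex statesE (readE sizeE rootE (var 0))) (eq nE (const 1))

end Expr

/-- The program that decides whether `b(G, s) ≤ t`. -/
def broadcastProgram : Program :=
  tableProgram Expr.tableSizeE (.add Expr.inputLengthE (.var 0)) (Expr.entryE (.var 0)) Expr.answerE

open RAM.Expr

variable {n : ℕ} {G : SimpleGraph (Fin n)} {s : Fin n} {t : ℕ} {D : TreeDecomposition G}
variable {X : ℕ} {m v : ℕ → ℕ} {xe σe je re : Expr} {x : Fin D.size} {r σ j : ℕ}

/-- The maximal size of a bag. -/
def _root_.TreeDecomposition.maxCard (D : TreeDecomposition G) : ℕ :=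
  Finset.univ.sup fun x => (D.bag x).card

/-- The number of states of a node. -/
def _root_.TreeDecomposition.numStates (D : TreeDecomposition G) (t : ℕ) : ℕ :=
  numRecords n t ^ D.maxCard

theorem numStates_pos (hn : 0 < n) : 0 < D.numStates t := Nat.pow_pos (numRecords_pos hn t)

/-- The meaning of the table: the level `r`, the node `x` and the state `σ` have an entry `1` iff
`σ` extends to the nodes less than `r` levels below `x`. -/
def Extends (D : TreeDecomposition G) (s : Fin n) (t r : ℕ) (x : Fin D.size)
    (σ : Fin (D.numStates t)) : Prop :=
  D.Alive (fun x (σ : Fin (numRecords n t ^ D.maxCard)) => D.IsLocal s t x (D.decode t x σ))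
    (fun y σ' σ => D.IsCompatible s t y (D.decode t y σ') (D.decode t (D.parent y) σ)) r x σ

/-- The meaning of the table entry with the number `j`. -/
def Entry (D : TreeDecomposition G) (s : Fin n) (t j : ℕ) : Prop :=
  Extends D s t (j / D.numStates t / D.size)
    ⟨j / D.numStates t % D.size, Nat.mod_lt _ D.root.pos⟩ ⟨j % D.numStates t,
      Nat.mod_lt _ (numStates_pos s.pos)⟩

theorem entry_iff (r : ℕ) (x : Fin D.size) (σ : Fin (D.numStates t)) :
    Entry D s t ((r * D.size + x) * D.numStates t + σ) ↔ Extends D s t r x σ := by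
  have hM := numStates_pos (D := D) (t := t) s.pos
  have e1 : ((r * D.size + x) * D.numStates t + σ) / D.numStates t = r * D.size + x := by
    rw [Nat.mul_comm, Nat.mul_add_div hM, Nat.div_eq_of_lt σ.isLt, Nat.add_zero]
  have e2 : ((r * D.size + x) * D.numStates t + σ) % D.numStates t = σ := by
    rw [Nat.mul_comm, Nat.mul_add_mod, Nat.mod_eq_of_lt σ.isLt]
  have e3 : (r * D.size + x) / D.size = r := by
    rw [Nat.mul_comm, Nat.mul_add_div D.root.pos, Nat.div_eq_of_lt x.isLt, Nat.add_zero]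
  have e4 : (r * D.size + x) % D.size = x := by
    rw [Nat.mul_comm, Nat.mul_add_mod, Nat.mod_eq_of_lt x.isLt]
  simp only [Entry, e1, e2, e3, e4, Fin.eta]

/-- Entries are numbered by level first, so all entries of lower levels are available when an entry
is computed. Thus the nodes need not be sorted by depth. -/
theorem entry_index_lt (hr : r < j / D.numStates t / D.size) (x : Fin D.size)
    (σ : Fin (D.numStates t)) : (r * D.size + x) * D.numStates t + σ < j := calc
  (r * D.size + x) * D.numStates t + σ < (j / D.numStates t / D.size * D.size) * D.numStates t :=
    Nat.mul_add_lt_mul_of_lt (Nat.mul_add_lt_mul_of_lt hr x.isLt) σ.isLt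
  _ ≤ j / D.numStates t * D.numStates t := Nat.mul_le_mul_right _ (Nat.div_mul_le_self _ _)
  _ ≤ j := Nat.div_mul_le_self _ _

/-- `X` is so large that loops of length `X` can handle the table. -/
structure TableFits (D : TreeDecomposition G) (t X : ℕ) : Prop extends Large n D.size t X where
  numStates_le : D.numStates t ≤ X
  table_le : (D.size + 1) * D.size * D.numStates t ≤ X

theorem Represents.val_states (h : Represents m G s t D) (hX : TableFits D t X) :
    Val X m statesE v (D.numStates t) := by
  refine (h.val_numRecords hX.toLarge).pow (h.val_maxCard hX.n_le hX.size_le) hX.numRecords_le ?_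
  refine Finset.sup_le fun x _ => (Finset.card_le_univ _).trans ?_
  rw [Fintype.card_fin]
  exact hX.n_le

theorem Represents.val_level (h : Represents m G s t D) (hX : TableFits D t X) (hj : j ≤ X)
    (hje : Val X m je v j) : Val X m (levelE je) v (j / D.numStates t / D.size) :=
  (hje.div (h.val_states hX) hj (numStates_pos s.pos)).div h.val_size
    ((Nat.div_le_self _ _).trans hj) D.root.pos

theorem Represents.val_node (h : Represents m G s t D) (hX : TableFits D t X) (hj : j ≤ X)
    (hje : Val X m je v j) : Val X m (nodeE je) v (j / D.numStates t % D.size) :=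
  (hje.div (h.val_states hX) hj (numStates_pos s.pos)).mod h.val_size
    ((Nat.div_le_self _ _).trans hj) D.root.pos

theorem Represents.val_state (h : Represents m G s t D) (hX : TableFits D t X) (hj : j ≤ X)
    (hje : Val X m je v j) : Val X m (stateE je) v (j % D.numStates t) :=
  hje.mod (h.val_states hX) hj (numStates_pos s.pos)

theorem Represents.val_read (h : Represents m G s t D) (hX : TableFits D t X)
    (hr : Val X m re v r) (hx : Val X m xe v x) (hσ : Val X m σe v σ) :
    Val X m (readE re xe σe) v
      (m (inputLength n D.size + ((r * D.size + x) * D.numStates t + σ))) :=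
  ((h.val_inputLength hX.n_le).add ((((hr.mul h.val_size hX.size_le).add hx).mul (h.val_states hX)
    hX.numStates_le).add hσ)).load

open Classical in
theorem Represents.val_entry (h : Represents m G s t D) (hX : TableFits D t X) (hj : j ≤ X)
    (hje : Val X m je v j) (hm : ∀ i < j, m (inputLength n D.size + i) ≠ 0 ↔ Entry D s t i) :
    Val X m (entryE je) v (if Entry D s t j then 1 else 0) := by
  have hn := hX.n_le
  have hσ : ∀ σ : Fin (D.numStates t), (σ : ℕ) ≤ X := fun σ => σ.isLt.le.trans hX.numStates_le
  have hj' : j % D.numStates t ≤ X := (Nat.mod_le _ _).trans hj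
  refine (Val.ite (h.val_level hX hj hje).tru (fun h0 => Tru.bit <| (Tru.congr <|
    Tru.and (h.tru_isLocal (x := ⟨j / D.numStates t % D.size, Nat.mod_lt _ D.root.pos⟩) hX.toLarge
      hj' (h.val_node hX hj hje) (h.val_state hX hj hje)) fun _ =>
    Tru.all h.val_size hX.size_le fun y => Tru.imp
      ((Tru.eq (Val.var 0) h.val_root).not.and fun _ => Tru.eq
        (h.val_parent (x := y) hn (Val.var 0)) (h.val_node hX hj hje.up)) fun _ =>
      Tru.ex (h.val_states hX) hX.numStates_le fun σ' => Tru.and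
        (h.tru_isCompatible (y := y) hX.toLarge hj' (hσ σ') (Val.var 1)
          (h.val_parent (x := y) hn (Val.var 1)) (h.val_state hX hj hje.up.up) (Val.var 0))
        fun _ => (h.val_read (x := y) (σ := σ') hX ((h.val_level hX hj hje.up.up).sub (Val.const 1))
          (Val.var 1) (Val.var 0)).tru) ?_) fun h0 => (Val.const 1).congr ?_).congr (ite_self _)
  · obtain ⟨r, hl⟩ := Nat.exists_eq_succ_of_ne_zero h0
    rw [Nat.succ_eq_add_one] at hl
    conv_rhs => rw [Entry, hl]
    rw [hl, Nat.add_sub_cancel]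
    simp only [Extends, Alive, push_zero]
    refine and_congr Iff.rfl (forall_congr' fun y => ?_)
    have hread := fun σ' => (hm _ (entry_index_lt (hl ▸ Nat.lt_succ_self r) y σ')).trans
      (entry_iff (s := s) r y σ')
    simp only [hread, IsChild, Fin.ext_iff, ne_eq]
    rfl
  · have : Entry D s t j := by
      rw [Entry, not_not.1 h0]
      trivial
    simp [this]

/-- For width 0 the time bound does not grow with `t`, so a loop of length `t` is not affordable.
The guard computes `2 ^ t` only after some bag is known to have two vertices. -/
theorem Represents.tru_guard (h : Represents m G s t D) (hn : n ≤ X) (hN : D.size ≤ X) (h2 : 2 ≤ X)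
    (ht : 1 < D.maxCard → t ≤ X) : Tru X m guardE v (1 < D.maxCard ∧ n ≤ 2 ^ t) :=
  (Tru.and (Tru.lt (Val.const 1) (h.val_maxCard hn hN)) fun hW =>
    (Tru.lt ((Val.const 2).pow h.val_t h2 (ht hW)) h.val_n).not).congr
    (by rw [not_lt]; rfl)

open Classical in
theorem Represents.val_tableSize (h : Represents m G s t D) (hn : n ≤ X) (hN : D.size ≤ X)
    (h2 : 2 ≤ X) (ht : 1 < D.maxCard → t ≤ X)
    (hX : 1 < D.maxCard ∧ n ≤ 2 ^ t → TableFits D t X) :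
    Val X m tableSizeE v (if 1 < D.maxCard ∧ n ≤ 2 ^ t then
      (D.size + 1) * D.size * D.numStates t else 0) :=
  Val.ite (h.tru_guard hn hN h2 ht) (fun hg => ((h.val_size.add (Val.const 1)).mul h.val_size hN).mul
    (h.val_states (hX hg)) (hX hg).numStates_le) fun _ => Val.const 0

/-- Without an edge in some bag, only a graph with a single vertex has a schedule. -/
theorem _root_.IsSchedule.eq_one_of_maxCard_le {a : Fin n → ℕ} {p : Fin n → Fin n}
    (h : IsSchedule G s t a p) (hD : D.maxCard ≤ 1) : n = 1 := by
  by_contra hn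
  have : Nontrivial (Fin n) := Fin.nontrivial_iff_two_le.2 (by have := s.pos; omega)
  obtain ⟨v, hv⟩ := exists_ne s
  obtain ⟨x, h1, h2⟩ := D.edge_covered _ _ (h.adj v hv)
  have hle : (D.bag x).card ≤ 1 :=
    le_trans (Finset.le_sup (f := fun x => (D.bag x).card) (Finset.mem_univ x)) hD
  exact (h.adj v hv).ne (Finset.card_le_one.1 hle _ h1 _ h2)

/-- Bags of size at most 1 leave no room for an edge, and `n > 2 ^ t` contradicts the doubling
bound; a single vertex is its own schedule. -/
theorem exists_isSchedule_iff_of_not (hg : ¬(1 < D.maxCard ∧ n ≤ 2 ^ t)) :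
    (∃ a p, IsSchedule G s t a p) ↔ n = 1 := by
  constructor
  · rintro ⟨a, p, h⟩
    refine h.eq_one_of_maxCard_le (D := D) ?_
    by_contra hW
    have := h.card_le_two_pow
    rw [Fintype.card_fin] at this
    exact hg ⟨by omega, this⟩
  · rintro rfl
    have hs : ∀ v : Fin 1, v ≠ s → False := fun v hv => hv (Subsingleton.elim _ _)
    exact ⟨fun _ => 0, id, fun v hv => (hs v hv).elim, fun v hv => (hs v hv).elim,
      fun _ => Nat.zero_le _, fun v _ _ hv => (hs v hv).elim⟩

open Classical in
theorem Represents.val_answer (h : Represents m G s t D) (hD : D.IsNice) (hn : n ≤ X)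
    (hN : D.size ≤ X) (h2 : 2 ≤ X) (ht : 1 < D.maxCard → t ≤ X)
    (hX : 1 < D.maxCard ∧ n ≤ 2 ^ t → TableFits D t X)
    (hm : 1 < D.maxCard ∧ n ≤ 2 ^ t → ∀ i < (D.size + 1) * D.size * D.numStates t,
      m (inputLength n D.size + i) ≠ 0 ↔ Entry D s t i) :
    Val X m answerE v (broadcastAnswer G s t) := by
  have key : Tru X m (ite guardE (ex statesE (readE sizeE rootE (var 0))) (eq nE (const 1))) v
      (∃ a p, IsSchedule G s t a p) := by
    have hguard := h.tru_guard (v := v) hn hN h2 ht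
    by_cases hg : 1 < D.maxCard ∧ n ≤ 2 ^ t
    · have hex := Tru.ex (h.val_states (v := v) (hX hg)) (hX hg).numStates_le fun σ =>
        (h.val_read (x := D.root) (σ := σ) (hX hg) h.val_size h.val_root (Val.var 0)).tru
      have hc := (Val.ite hguard (fun _ => ⟨rfl, hex.fits⟩) fun h0 => absurd hg h0 :
        Val X m (ite guardE (ex statesE (readE sizeE rootE (var 0))) (eq nE (const 1))) v
          (if _ then _ else 0)).tru
      rw [if_pos hg] at hc
      refine (hc.congr hex.eval).congr ?_
      rw [← exists_alive_decode_iff hD s t D.maxCard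
        fun x => Finset.le_sup (f := fun x => (D.bag x).card) (Finset.mem_univ x)]
      refine exists_congr fun σ => ?_
      rw [hm hg _ ?_, entry_iff]
      · rfl
      · refine Nat.mul_add_lt_mul_of_lt (Nat.mul_add_lt_mul_of_lt ?_ D.root.isLt) σ.isLt
        exact Nat.lt_succ_self _
    · have hn1 : Tru X m (eq nE (const 1)) v (n = 1) := Tru.eq h.val_n (Val.const 1)
      have hc := (Val.ite hguard (fun h0 => absurd h0 hg) fun _ => ⟨rfl, hn1.fits⟩ :
        Val X m (ite guardE (ex statesE (readE sizeE rootE (var 0))) (eq nE (const 1))) v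
          (if _ then 0 else _)).tru
      rw [if_neg hg] at hc
      exact (hc.congr hn1.eval).congr (exists_isSchedule_iff_of_not hg).symm
  refine (key.congr broadcastTime_le_iff.symm).bit.congr ?_
  unfold broadcastAnswer
  congr

/-- The running time of the program if loops have at most `X` rounds. -/
def programTime (X : ℕ) : ℕ :=
  tableSizeE.time X + X * ((Expr.add inputLengthE (var 0)).time X + (entryE (var 0)).time X + 3 + 1) +
    answerE.time X + 5

theorem outputsWithin_broadcastProgram (hD : D.IsNice) (hn : n ≤ X) (hN : D.size ≤ X) (h2 : 2 ≤ X)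
    (ht : 1 < D.maxCard → t ≤ X) (hX : 1 < D.maxCard ∧ n ≤ 2 ^ t → TableFits D t X) :
    OutputsWithin broadcastProgram (encodeInput G s t D) (broadcastAnswer G s t)
      (programTime X) := by
  classical
  let M : ℕ → ℕ → ℕ := fun j => Nat.rec (initial (encodeInput G s t D)).mem
    (fun j m => Function.update m ((Expr.add inputLengthE (var 0)).eval m (push j fun _ => 0))
      ((entryE (var 0)).eval m (push j fun _ => 0))) j
  have hM0 : M 0 = (initial (encodeInput G s t D)).mem := rfl
  have hMs : ∀ j, M (j + 1) = Function.update (M j)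
      ((Expr.add inputLengthE (var 0)).eval (M j) (push j fun _ => 0))
      ((entryE (var 0)).eval (M j) (push j fun _ => 0)) := fun j => rfl
  clear_value M
  have h0 : Represents (M 0) G s t D := hM0 ▸ represents_initial G s t D
  have haddr : ∀ {m : ℕ → ℕ}, Represents m G s t D → ∀ j, Val X m (.add inputLengthE (var 0))
      (push j fun _ => 0) (inputLength n D.size + j) :=
    fun h j => (h.val_inputLength hn).add (Val.var 0)
  by_cases hg : 1 < D.maxCard ∧ n ≤ 2 ^ t
  · have hT := hX hg
    have inv : ∀ j ≤ (D.size + 1) * D.size * D.numStates t, Represents (M j) G s t D ∧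
        ∀ i < j, M j (inputLength n D.size + i) ≠ 0 ↔ Entry D s t i := by
      intro j
      induction j with
      | zero => exact fun _ => ⟨h0, fun i hi => absurd hi (Nat.not_lt_zero i)⟩
      | succ j ih =>
        intro hj
        obtain ⟨ih1, ih2⟩ := ih (by omega)
        have he := ih1.val_entry (v := push j fun _ => 0) (j := j) hT (le_trans (by omega) hT.table_le)
          (Val.var 0) ih2
        rw [hMs, (haddr ih1 j).eval, he.eval]
        refine ⟨ih1.congr fun i hi => Function.update_of_ne (by omega) _ _, fun i hi => ?_⟩
        rcases Nat.lt_succ_iff_lt_or_eq.1 hi with hi | rfl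
        · rw [Function.update_of_ne (by omega)]
          exact ih2 i hi
        · rw [Function.update_self]
          split_ifs with h <;> simp [h]
    have hk := h0.val_tableSize (v := fun _ => 0) hn hN h2 ht hX
    rw [if_pos hg] at hk
    obtain ⟨i1, i2⟩ := inv _ le_rfl
    have ha := i1.val_answer (v := fun _ => 0) hD hn hN h2 ht hX fun _ => i2
    rw [← ha.eval]
    refine outputsWithin_tableProgram M hM0 hk.eval hk.fits hT.table_le (fun j _ => hMs j)
      (fun j hj => (haddr (inv j hj.le).1 j).fits) (fun j hj => ?_) ha.fits
    exact ((inv j hj.le).1.val_entry hT (hj.le.trans hT.table_le) (Val.var 0) (inv j hj.le).2).fits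
  · have hk := h0.val_tableSize (v := fun _ => 0) hn hN h2 ht hX
    rw [if_neg hg] at hk
    have ha := h0.val_answer (v := fun _ => 0) hD hn hN h2 ht hX fun h => absurd h hg
    rw [← ha.eval]
    exact outputsWithin_tableProgram M hM0 hk.eval hk.fits (Nat.zero_le _) (fun j _ => hMs j)
      (fun j hj => absurd hj (Nat.not_lt_zero j)) (fun j hj => absurd hj (Nat.not_lt_zero j)) ha.fits

end RAM

namespace RAM

open TreeDecomposition

open RAM.Expr

/-! ### The running time -/

theorem exists_programTime_le : ∃ c, ∀ X, 1 ≤ X → programTime X ≤ c * X ^ c := by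
  -- This expression is never evaluated. It is built so that its `time` dominates that of the
  -- program, with `iter` standing for the loop that fills the table.
  obtain ⟨c, hc⟩ := time_le (add (add tableSizeE (iter (const 0) (const 0)
    (add (add inputLengthE (var 0)) (entryE (var 0))))) answerE)
  refine ⟨c, fun X hX => le_trans ?_ (hc X hX)⟩
  simp only [programTime, time]
  have h : X * (time X inputLengthE + 2 + 1 + time X (entryE (var 0)) + 3 + 1) ≤
      X * (time X inputLengthE + 2 + 1 + time X (entryE (var 0)) + 1 + 5) := Nat.mul_le_mul_left _ (by omega)
  omega

variable {n : ℕ} {G : SimpleGraph (Fin n)} {s : Fin n} {t : ℕ} {D : TreeDecomposition G}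

theorem maxCard_le (D : TreeDecomposition G) : D.maxCard ≤ n :=
  Finset.sup_le fun _ _ => (Finset.card_le_univ _).trans (Fintype.card_fin n).le

theorem numRecords_le (hn : n ≤ 2 ^ t) : numRecords n t ≤ 2 ^ (4 * t + 2) := by
  have h1 : t + 1 ≤ 2 ^ t := Nat.lt_two_pow_self
  have h3 : 3 ^ (t + 1) ≤ 2 ^ (2 * (t + 1)) := by
    rw [pow_mul]
    exact Nat.pow_le_pow_left (by norm_num) _
  calc numRecords n t ≤ 2 ^ t * 2 ^ t * 2 ^ (2 * (t + 1)) :=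
        Nat.mul_le_mul (Nat.mul_le_mul h1 hn) h3
    _ = 2 ^ (4 * t + 2) := by
        rw [← pow_add, ← pow_add]
        congr 1
        ring

theorem numStates_le (hg : 1 < D.maxCard ∧ n ≤ 2 ^ t) :
    D.numStates t ≤ 2 ^ (12 * (t * D.width)) := by
  have ht : 1 ≤ t := by
    have := maxCard_le D
    by_contra h
    obtain rfl : t = 0 := by omega
    simp at hg
    omega
  have hw : D.maxCard = D.width + 1 := by
    have : D.width = D.maxCard - 1 := rfl
    omega
  have hw1 : 1 ≤ D.width := by omega
  rw [numStates, hw]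
  calc numRecords n t ^ (D.width + 1) ≤ (2 ^ (4 * t + 2)) ^ (D.width + 1) :=
        Nat.pow_le_pow_left (numRecords_le hg.2) _
    _ = 2 ^ ((4 * t + 2) * (D.width + 1)) := (pow_mul _ _ _).symm
    _ ≤ 2 ^ (12 * (t * D.width)) := by
        refine Nat.pow_le_pow_right (by norm_num) ?_
        -- Since `t` and the width are at least 1, `4 * t + 2 ≤ 6 * t` and `width + 1 ≤ 2 * width`;
        -- hence the constant 12.
        nlinarith [Nat.mul_le_mul ht hw1]

/-- A bound on the length of all loops. -/
def loopBound (D : TreeDecomposition G) (t : ℕ) : ℕ :=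
  2 * 2 ^ (12 * (t * D.width)) * (n + D.size) ^ 2

theorem le_loopBound {k : ℕ} (h : k ≤ 2 * (n + D.size) ^ 2) : k ≤ loopBound D t := by
  have : 0 < 2 ^ (12 * (t * D.width)) := by positivity
  rw [loopBound, Nat.mul_right_comm]
  exact h.trans (Nat.le_mul_of_pos_right _ this)

theorem two_pow_le_loopBound (s : Fin n) : 2 ^ (12 * (t * D.width)) ≤ loopBound D t := by
  have : 0 < (n + D.size) ^ 2 := by
    have := s.pos
    positivity
  rw [loopBound, Nat.mul_right_comm]
  exact Nat.le_mul_of_pos_left _ (by positivity)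

/-- Here the width is positive, so `t ≤ t * width` and the exponential factor exceeds `t`. -/
theorem lt_loopBound (s : Fin n) (hD : 1 < D.maxCard) : t < loopBound D t := by
  have hw : D.width = D.maxCard - 1 := rfl
  refine lt_of_lt_of_le ?_ (two_pow_le_loopBound s)
  refine lt_of_lt_of_le Nat.lt_two_pow_self (Nat.pow_le_pow_right (by norm_num) ?_)
  have := Nat.le_mul_of_pos_right t (show 0 < D.width by omega)
  omega

theorem tableFits_loopBound (s : Fin n) (hg : 1 < D.maxCard ∧ n ≤ 2 ^ t) :
    TableFits D t (loopBound D t) := by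
  have hN := D.root.pos
  have hn := s.pos
  have hM := numStates_le hg
  have hsq : n + D.size ≤ (n + D.size) ^ 2 := Nat.le_self_pow (by norm_num) _
  refine ⟨⟨le_loopBound (by omega), le_loopBound (by omega), lt_loopBound s hg.1, ?_⟩,
    hM.trans (two_pow_le_loopBound s), ?_⟩
  · refine le_trans ?_ (hM.trans (two_pow_le_loopBound s))
    exact Nat.le_self_pow (by omega) _
  · calc (D.size + 1) * D.size * D.numStates t
        ≤ 2 * (n + D.size) ^ 2 * 2 ^ (12 * (t * D.width)) := by
          refine Nat.mul_le_mul ?_ hM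
          nlinarith
      _ = loopBound D t := by rw [loopBound, Nat.mul_right_comm]

theorem OutputsWithin.mono {P : Program} {l : List ℕ} {o B B' : ℕ} (h : OutputsWithin P l o B)
    (hB : B ≤ B') : OutputsWithin P l o B' := by
  obtain ⟨k, hk, h⟩ := h
  exact ⟨k, hk.trans hB, h⟩

theorem exists_outputsWithin_broadcastProgram :
    ∃ c : ℕ, ∀ (n : ℕ) (G : SimpleGraph (Fin n)) (s : Fin n) (t : ℕ) (D : TreeDecomposition G),
      D.IsNice → OutputsWithin broadcastProgram (encodeInput G s t D) (broadcastAnswer G s t)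
        (c * 2 ^ (c * (t * D.width)) * (n + D.size) ^ c) := by
  obtain ⟨c, hc⟩ := exists_programTime_le
  -- Raising `loopBound` to the power `c` gives the factor `c * 2 ^ c`, the exponent `12 * c` of the
  -- exponential part, and the degree `2 * c`; the constant dominates all three.
  refine ⟨c * 2 ^ c + 12 * c, fun n G s t D hD => ?_⟩
  have hN := D.root.pos
  have hn := s.pos
  have hsq : n + D.size ≤ (n + D.size) ^ 2 := Nat.le_self_pow (by norm_num) _
  refine (outputsWithin_broadcastProgram (X := loopBound D t) hD (le_loopBound (by omega))
    (le_loopBound (by omega)) (le_loopBound (by omega)) (fun h => (lt_loopBound s h).le)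
    (tableFits_loopBound s)).mono ?_
  refine (hc _ (le_loopBound (by omega))).trans ?_
  calc c * loopBound D t ^ c
      = c * 2 ^ c * 2 ^ (12 * c * (t * D.width)) * (n + D.size) ^ (2 * c) := by
        rw [loopBound, mul_pow, mul_pow, ← pow_mul, ← pow_mul]
        rw [show 12 * (t * D.width) * c = 12 * c * (t * D.width) by ring]
        ring
    _ ≤ _ := by
        refine Nat.mul_le_mul (Nat.mul_le_mul (Nat.le_add_right _ _) ?_) ?_
        · exact Nat.pow_le_pow_right (by norm_num) (Nat.mul_le_mul_right _ (Nat.le_add_left _ _))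
        · exact Nat.pow_le_pow_right (by omega) (by omega)

end RAM

/-! ### The main theorem -/

theorem mainTheorem8 :
    ∃ P : RAM.Program,
      (∃ c : ℕ, ∀ (n : ℕ) (G : SimpleGraph (Fin n)) (s : Fin n) (t : ℕ) (D : TreeDecomposition G),
        D.IsNice →
          RAM.OutputsWithin P (encodeInput G s t D) (broadcastAnswer G s t)
            (c * 2 ^ (c * (t * D.width)) * (n + D.size) ^ c)) ∧
      (∀ a : ℕ, ∃ c : ℕ,
        ∀ (n : ℕ) (G : SimpleGraph (Fin n)) (s : Fin n) (t : ℕ) (D : TreeDecomposition G),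
          D.IsNice → D.size ≤ a * n ^ a →
            RAM.OutputsWithin P (encodeInput G s t D) (broadcastAnswer G s t)
              (c * 2 ^ (c * (t * D.width)) * n ^ c)) := by
  obtain ⟨c, hc⟩ := RAM.exists_outputsWithin_broadcastProgram
  -- From `n + D.size ≤ (a + 1) * n ^ (a + 1)`, the `c`-th power contributes the factor `(a + 1) ^
  -- c` and the degree `(a + 1) * c`; the last summand covers the exponent of 2.
  refine ⟨RAM.broadcastProgram, ⟨c, hc⟩, fun a => ⟨c * (a + 1) ^ c + (a + 1) * c + c,
    fun n G s t D hD hN => (hc n G s t D hD).mono ?_⟩⟩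
  have hn : 1 ≤ n := s.pos
  have h1 : n + D.size ≤ (a + 1) * n ^ (a + 1) := by
    have e1 : n ≤ n ^ (a + 1) := Nat.le_self_pow (by omega) n
    have e2 := Nat.mul_le_mul_left a (Nat.pow_le_pow_right hn (Nat.le_succ a))
    rw [Nat.add_mul, Nat.one_mul]
    rw [Nat.succ_eq_add_one] at e2
    omega
  calc c * 2 ^ (c * (t * D.width)) * (n + D.size) ^ c
      ≤ c * 2 ^ (c * (t * D.width)) * ((a + 1) * n ^ (a + 1)) ^ c :=
        Nat.mul_le_mul_left _ (Nat.pow_le_pow_left h1 c)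
    _ = c * (a + 1) ^ c * 2 ^ (c * (t * D.width)) * n ^ ((a + 1) * c) := by
        rw [mul_pow, ← pow_mul]
        ring
    _ ≤ _ := by
        refine Nat.mul_le_mul (Nat.mul_le_mul (by omega) ?_) ?_
        · exact Nat.pow_le_pow_right (by norm_num) (Nat.mul_le_mul_right _ (by omega))
        · exact Nat.pow_le_pow_right hn (by omega)
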